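/- **Setting.** Fix integers $I,J,r\ge 0$, a tuning parameter $\gamma\ge 0$, inspection times $\tau_1,\dots,\tau_I>0$ and stress vectors $\boldsymbol x_i=(x_{i0},\dots,x_{iJ})\in\mathbb R^{J+1}$. For $\boldsymbol\theta=(a_0,\dots,a_J,b_0,\dots,b_J)\in\mathbb R^{2(J+1)}$ put $\alpha_i=\exp(\sum_j a_jx_{ij})$, $\beta_i=\exp(\sum_j b_jx_{ij})$, $$F_i(\boldsymbol\theta)=\frac{\tau_i^{\beta_i}}{\tau_i^{\beta_i}+\alpha_i^{\beta_i}},\qquad R_i(\boldsymbol\theta)=\frac{\alpha_i^{\beta_i}}{\tau_i^{\beta_i}+\alpha_i^{\beta_i}} .$$ Consider a sequence of one-shot device experiments. In each of them $K_i$ devices are placed under condition $i$ $(i=1,\dots,I)$, and $K=\sum_i K_i$; along the sequence $K\to\infty$ and $K_i/K\to w_i$ for every $i$. Within each experiment all device lifetimes are independent, and under condition $i$ they follow the log-logistic law with density $\beta_i\alpha_i^{\beta_i}t^{\beta_i-1}/(t^{\beta_i}+\alpha_i^{\beta_i})^2$, $t>0$, with $\alpha_i,\beta_i$ evaluated at the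 true parameter $\boldsymbol\theta_0$. Only the numbers $n_i$ of devices under condition $i$ whose lifetime is at most $\tau_i$ are observed. Let $\boldsymbol m:\mathbb R^{2(J+1)}\to\mathbb R^r$ satisfy $\boldsymbol m(\boldsymbol\theta_0)=\boldsymbol 0$, be differentiable in a neighbourhood of $\boldsymbol\theta_0$, and be such that the $2(J+1)\times r$ matrix $\boldsymbol M(\boldsymbol\theta)=\partial\boldsymbol m(\boldsymbol\theta)^T/\partial\boldsymbol\theta$ is continuous at $\boldsymbol\theta_0$ with $\operatorname{rank}\boldsymbol M(\boldsymbol\theta_0)=r$. Let $$\boldsymbol U_\gamma(\boldsymbol\theta)=\sum_{i=1}^I\Bigl(-\beta_i\boldsymbol x_i,\ \log\tfrac{\tau_i}{\alpha_i}\,\beta_i\boldsymbol x_i\Bigr)^T\Bigl(K_i\tfrac{\tau_i^{\beta_i}}{\tau_i^{\beta_i}+\alpha_i^{\beta_i}}-n_i\Bigr)\frac{\tau_i^{\beta_i\gamma}\alpha_i^{\beta_i}+\alpha_i^{\beta_i\gamma}\tau_i^{\beta_i}}{(\tau_i^{\beta_i}+\alpha_i^{\beta_i})^{\gamma+1}}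 .$$ A *root* of the estimating equations of the restricted weighted minimum density power divergence estimator (RWMDPDE) is a $\boldsymbol\theta$ for which some $\boldsymbol\lambda\in\mathbb R^r$ satisfies $$\boldsymbol U_\gamma(\boldsymbol\theta)+\boldsymbol M(\boldsymbol\theta)\boldsymbol\lambda=\boldsymbol 0,\qquad \boldsymbol m(\boldsymbol\theta)=\boldsymbol 0 .$$ A sequence of random vectors $\tilde{\boldsymbol\theta}_\gamma$ (one for each experiment) is a *consistent sequence of roots* if the probability that $\tilde{\boldsymbol\theta}_\gamma$ is a root tends to $1$ and $\tilde{\boldsymbol\theta}_\gamma\to\boldsymbol\theta_0$ in probability. Finally let $$\boldsymbol J_\gamma=\sum_i w_i\bigl(F_i^{\gamma-1}+R_i^{\gamma-1}\bigr)\frac{\partial F_i}{\partial\boldsymbol\theta}\frac{\partial F_i}{\partial\boldsymbol\theta^T},\qquad \boldsymbol K_\gamma=\sum_i w_iF_iR_i\bigl(F_i^{\gamma-1}+R_i^{\gamma-1}\bigr)^2\frac{\partial F_i}{\partial\boldsymbol\theta}\frac{\partial F_i}{\partial\boldsymbol\theta^T},$$ and assume that $\boldsymbol J_\gamma(\boldsymbol\theta_0)$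 is invertible. **Theorem (properties of the RWMDPDE: consistency and asymptotic normality).** a) There is a consistent sequence of roots $\tilde{\boldsymbol\theta}_\gamma$ in which each $\tilde{\boldsymbol\theta}_\gamma$ is a function of the observed counts $(n_1,\dots,n_I)$. b) For every consistent sequence of (measurable) roots, $$\sqrt K\,(\tilde{\boldsymbol\theta}_\gamma-\boldsymbol\theta_0)\ \xrightarrow{\ \mathcal L\ }\ N\bigl(\boldsymbol 0,\ \boldsymbol P_\gamma(\boldsymbol\theta_0)\boldsymbol K_\gamma(\boldsymbol\theta_0)\boldsymbol P_\gamma(\boldsymbol\theta_0)\bigr),$$ where $\boldsymbol P_\gamma=\boldsymbol J_\gamma^{-1}-\boldsymbol Q_\gamma\boldsymbol M^T\boldsymbol J_\gamma^{-1}$ and $\boldsymbol Q_\gamma=\boldsymbol J_\gamma^{-1}\boldsymbol M(\boldsymbol M^T\boldsymbol J_\gamma^{-1}\boldsymbol M)^{-1}$. -/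

import Mathlib

open MeasureTheory ProbabilityTheory Filter Topology Matrix

namespace OneShot

noncomputable section

/-! ### The log-logistic distribution -/

/-- Density of the log-logistic distribution with scale `α` and shape `β`. -/
def logLogisticPDF (α β t : ℝ) : ℝ :=
  if 0 < t then β * α ^ β * t ^ (β - 1) / (t ^ β + α ^ β) ^ 2 else 0

/-- The log-logistic law on `ℝ`, for `α, β > 0`. -/
def logLogisticMeasure (α β : ℝ) : Measure ℝ :=
  volume.withDensity fun t => ENNReal.ofReal (logLogisticPDF α β t)

/-- Log-logistic distribution function at `t > 0`. -/
def logLogisticCDF (α β t : ℝ) : ℝ := t ^ β / (t ^ β + α ^ β)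

/-- Log-logistic reliability function at `t > 0`. -/
def logLogisticReliability (α β t : ℝ) : ℝ := α ^ β / (t ^ β + α ^ β)

/-! ### The log-linear model

A parameter `θ = (a_0, …, a_J, b_0, …, b_J)` is a vector indexed by
`Fin (J + 1) ⊕ Fin (J + 1)`: the left summand carries the `a_j`, the right one the `b_j`. -/

/-- Index set of the coordinates of the parameter. -/
abbrev Coord (J : ℕ) : Type := Fin (J + 1) ⊕ Fin (J + 1)

/-- The parameter space `ℝ^{2(J+1)}`. -/
abbrev Param (J : ℕ) : Type := EuclideanSpace ℝ (Coord J)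

variable {J I r : ℕ}

/-- Scale parameter `exp (∑ j, a_j x_j)` under the testing condition `x`. -/
def scale (x : Fin (J + 1) → ℝ) (θ : Param J) : ℝ :=
  Real.exp (∑ j, θ (Sum.inl j) * x j)

/-- Shape parameter `exp (∑ j, b_j x_j)` under the testing condition `x`. -/
def shape (x : Fin (J + 1) → ℝ) (θ : Param J) : ℝ :=
  Real.exp (∑ j, θ (Sum.inr j) * x j)

/-- `F_θ(t, x)`: probability of failure before the inspection time `t`. -/
def failProb (t : ℝ) (x : Fin (J + 1) → ℝ) (θ : Param J) : ℝ :=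
  logLogisticCDF (scale x θ) (shape x θ) t

/-- `R_θ(t, x)`: probability of surviving the inspection time `t`. -/
def survProb (t : ℝ) (x : Fin (J + 1) → ℝ) (θ : Param J) : ℝ :=
  logLogisticReliability (scale x θ) (shape x θ) t

/-- The vector of partial derivatives `∂F_θ(t, x)/∂θ`. -/
def gradFailProb (t : ℝ) (x : Fin (J + 1) → ℝ) (θ : Param J) : Coord J → ℝ :=
  fun s => fderiv ℝ (failProb t x) θ (EuclideanSpace.single s 1)

/-! ### The data -/

/-- Number of failures observed among the devices of one testing condition, whose lifetimes
are `T k`, at the inspection time `t`. -/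
def failures {κ : ℕ} {Ω : Type*} (T : Fin κ → Ω → ℝ) (t : ℝ) (ω : Ω) : ℕ := by
  classical exact (Finset.univ.filter fun k => T k ω ≤ t).card

/-! ### Restricted estimating equations -/

/-- The estimating function `U_γ(θ)` of the weighted minimum density power divergence estimator,
when `K i` devices are placed under condition `i` and `n i` of them fail. -/
def estFun (γ : ℝ) (τ : Fin I → ℝ) (x : Fin I → Fin (J + 1) → ℝ) (K n : Fin I → ℕ)
    (θ : Param J) : Coord J → ℝ :=
  ∑ i, ((((K i : ℝ) * (τ i ^ shape (x i) θ /
          (τ i ^ shape (x i) θ + scale (x i) θ ^ shape (x i) θ)) - (n i : ℝ)) *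
      ((τ i ^ (shape (x i) θ * γ) * scale (x i) θ ^ shape (x i) θ +
          scale (x i) θ ^ (shape (x i) θ * γ) * τ i ^ shape (x i) θ) /
        (τ i ^ shape (x i) θ + scale (x i) θ ^ shape (x i) θ) ^ (γ + 1))) •
    Sum.elim (fun j => -(shape (x i) θ * x i j))
      (fun j => Real.log (τ i / scale (x i) θ) * (shape (x i) θ * x i j)))

/-- The `2(J+1) × r` matrix `M(θ) = ∂m(θ)ᵀ/∂θ` of a restriction function `m`. -/
def restrMatrix (m : Param J → EuclideanSpace ℝ (Fin r)) (θ : Param J) :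
    Matrix (Coord J) (Fin r) ℝ :=
  Matrix.of fun s l => fderiv ℝ m θ (EuclideanSpace.single s 1) l

/-- `θ` solves the restricted estimating equations `U_γ(θ) + M(θ) lam = 0`, `m(θ) = 0`
for some vector `lam` of Lagrange multipliers. -/
def IsRestrictedRoot (γ : ℝ) (τ : Fin I → ℝ) (x : Fin I → Fin (J + 1) → ℝ)
    (m : Param J → EuclideanSpace ℝ (Fin r)) (K n : Fin I → ℕ) (θ : Param J) : Prop :=
  (∃ lam : Fin r → ℝ, estFun γ τ x K n θ + restrMatrix m θ *ᵥ lam = 0) ∧ m θ = 0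

/-! ### The matrices of the asymptotic distribution

`w i` is the (limiting) proportion `K_i / K` of devices placed under condition `i`. -/

/-- The matrix `J_γ(θ)`. -/
def matJ (γ : ℝ) (τ : Fin I → ℝ) (x : Fin I → Fin (J + 1) → ℝ) (w : Fin I → ℝ)
    (θ : Param J) : Matrix (Coord J) (Coord J) ℝ :=
  ∑ i, (w i * (failProb (τ i) (x i) θ ^ (γ - 1) + survProb (τ i) (x i) θ ^ (γ - 1))) •
    Matrix.vecMulVec (gradFailProb (τ i) (x i) θ) (gradFailProb (τ i) (x i) θ)

/-- The matrix `K_γ(θ)`. -/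
def matK (γ : ℝ) (τ : Fin I → ℝ) (x : Fin I → Fin (J + 1) → ℝ) (w : Fin I → ℝ)
    (θ : Param J) : Matrix (Coord J) (Coord J) ℝ :=
  ∑ i, (w i * (failProb (τ i) (x i) θ * survProb (τ i) (x i) θ *
      (failProb (τ i) (x i) θ ^ (γ - 1) + survProb (τ i) (x i) θ ^ (γ - 1)) ^ 2)) •
    Matrix.vecMulVec (gradFailProb (τ i) (x i) θ) (gradFailProb (τ i) (x i) θ)

/-- `Q = 𝒥⁻¹ M (Mᵀ 𝒥⁻¹ M)⁻¹`. -/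
def matQ (𝒥 : Matrix (Coord J) (Coord J) ℝ) (M : Matrix (Coord J) (Fin r) ℝ) :
    Matrix (Coord J) (Fin r) ℝ :=
  𝒥⁻¹ * M * (Mᵀ * 𝒥⁻¹ * M)⁻¹

/-- `P = 𝒥⁻¹ - Q Mᵀ 𝒥⁻¹`. -/
def matP (𝒥 : Matrix (Coord J) (Coord J) ℝ) (M : Matrix (Coord J) (Fin r) ℝ) :
    Matrix (Coord J) (Coord J) ℝ :=
  𝒥⁻¹ - matQ 𝒥 M * Mᵀ * 𝒥⁻¹

/-- The asymptotic covariance matrix `P_γ(θ) K_γ(θ) P_γ(θ)`. -/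
def asympCov (γ : ℝ) (τ : Fin I → ℝ) (x : Fin I → Fin (J + 1) → ℝ) (w : Fin I → ℝ)
    (m : Param J → EuclideanSpace ℝ (Fin r)) (θ : Param J) : Matrix (Coord J) (Coord J) ℝ :=
  matP (matJ γ τ x w θ) (restrMatrix m θ) * matK γ τ x w θ *
    matP (matJ γ τ x w θ) (restrMatrix m θ)

end

end OneShot

open Asymptotics

namespace OneShot

noncomputable section

variable {J I r : ℕ}

/-! ### The log-logistic model -/

/-! Dividing by the total number of devices turns the estimating equations into equations in the
proportions `k` and the failure frequencies `y`, with estimating function `score`. It is the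
gradient of `potential`, a sum of integrals of `(k i * u - y i) * powerWeight γ u` in the failure
probability `u`. Roots of the restricted equations are therefore the critical points of `potential`
on the constraint set.

Existence: at the limiting frequencies each summand is minimal exactly at the true failure
probability, and invertibility of `J` makes the failure probabilities with positive weight identify
`θ₀` locally. So `θ₀` is a strict local minimiser. By compactness a constrained local minimiser
survives near `θ₀` for all nearby frequencies (`eventually_exists_isLocalMinOn`), and the Lagrange
rule (`eventually_ker_le_of_isLocalMinOn`) makes it a root (`eventually_exists_root`). Chebyshev's
inequality puts the observed frequencies near their limits with probability tending to one.

Normality: `matP`, formed with the restriction matrix at the root, annihilates that matrix and so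
eliminates the multipliers. Linearising what remains expresses any root near `θ₀` as a linear
function of the centred frequencies plus a smaller error (`root_expansion`). This is deterministic,
so it applies to every consistent sequence of roots. The linear part is a sum of independent centred
Bernoulli variables, whose characteristic functions converge to the Gaussian one
(`tendstoInDistribution_sum_failures`). Slutsky's lemma finishes. -/

/-- The linear functional `θ ↦ ∑ j, a_j x_j`. -/
def scaleForm (x : Fin (J + 1) → ℝ) : Param J →L[ℝ] ℝ :=
  ∑ j, x j • (EuclideanSpace.proj (Sum.inl j) : Param J →L[ℝ] ℝ)

/-- The linear functional `θ ↦ ∑ j, b_j x_j`. -/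
def shapeForm (x : Fin (J + 1) → ℝ) : Param J →L[ℝ] ℝ :=
  ∑ j, x j • (EuclideanSpace.proj (Sum.inr j) : Param J →L[ℝ] ℝ)

lemma scaleForm_apply (x : Fin (J + 1) → ℝ) (θ : Param J) :
    scaleForm x θ = ∑ j, θ (Sum.inl j) * x j := by
  simp [scaleForm, _root_.sum_apply, mul_comm]

lemma shapeForm_apply (x : Fin (J + 1) → ℝ) (θ : Param J) :
    shapeForm x θ = ∑ j, θ (Sum.inr j) * x j := by
  simp [shapeForm, _root_.sum_apply, mul_comm]

lemma scale_eq (x : Fin (J + 1) → ℝ) (θ : Param J) : scale x θ = Real.exp (scaleForm x θ) := by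
  rw [scaleForm_apply, scale]

lemma shape_eq (x : Fin (J + 1) → ℝ) (θ : Param J) : shape x θ = Real.exp (shapeForm x θ) := by
  rw [shapeForm_apply, shape]

lemma scale_pos (x : Fin (J + 1) → ℝ) (θ : Param J) : 0 < scale x θ := Real.exp_pos _

lemma shape_pos (x : Fin (J + 1) → ℝ) (θ : Param J) : 0 < shape x θ := Real.exp_pos _

/-- The logit of the distribution function is affine in `log t`, so smoothness, bounds and
derivatives in the parameter reduce to those of the sigmoid. -/
lemma logLogisticCDF_eq_sigmoid {α β t : ℝ} (hα : 0 < α) (ht : 0 < t) :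
    logLogisticCDF α β t = Real.sigmoid (β * (Real.log t - Real.log α)) := by
  rw [logLogisticCDF, Real.rpow_def_of_pos ht, Real.rpow_def_of_pos hα, Real.sigmoid_def]
  have h1 := Real.exp_pos (Real.log t * β)
  have h : Real.exp (-(β * (Real.log t - Real.log α))) =
      Real.exp (Real.log α * β) / Real.exp (Real.log t * β) := by
    rw [← Real.exp_sub]; ring_nf
  rw [h]
  field_simp

lemma failProb_eq_sigmoid {t : ℝ} (ht : 0 < t) (x : Fin (J + 1) → ℝ) (θ : Param J) :
    failProb t x θ =
      Real.sigmoid (Real.exp (shapeForm x θ) * (Real.log t - scaleForm x θ)) := by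
  rw [failProb, logLogisticCDF_eq_sigmoid (scale_pos _ _) ht, shape_eq, scale_eq, Real.log_exp]

lemma failProb_pos {t : ℝ} (ht : 0 < t) (x : Fin (J + 1) → ℝ) (θ : Param J) :
    0 < failProb t x θ := by
  rw [failProb_eq_sigmoid ht]; exact Real.sigmoid_pos _

lemma failProb_lt_one {t : ℝ} (ht : 0 < t) (x : Fin (J + 1) → ℝ) (θ : Param J) :
    failProb t x θ < 1 := by
  rw [failProb_eq_sigmoid ht]; exact Real.sigmoid_lt_one _

lemma survProb_eq {t : ℝ} (ht : 0 < t) (x : Fin (J + 1) → ℝ) (θ : Param J) :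
    survProb t x θ = 1 - failProb t x θ := by
  have h1 := Real.rpow_pos_of_pos ht (shape x θ)
  have h2 := Real.rpow_pos_of_pos (scale_pos x θ) (shape x θ)
  rw [survProb, failProb, logLogisticReliability, logLogisticCDF]
  field_simp
  ring

lemma contDiff_failProb {t : ℝ} (ht : 0 < t) (x : Fin (J + 1) → ℝ) :
    ContDiff ℝ 1 (failProb t x) := by
  have h : failProb t x = Real.sigmoid ∘ fun θ : Param J =>
      Real.exp (shapeForm x θ) * (Real.log t - scaleForm x θ) := by
    ext θ; exact failProb_eq_sigmoid ht x θ
  rw [h]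
  refine (contDiff_sigmoid.of_le (by simp)).comp ?_
  fun_prop

lemma gradFailProb_dotProduct (t : ℝ) (x : Fin (J + 1) → ℝ) (θ v : Param J) :
    gradFailProb t x θ ⬝ᵥ v = fderiv ℝ (failProb t x) θ v := by
  conv_rhs => rw [← (EuclideanSpace.basisFun (Coord J) ℝ).sum_repr v]
  simp [map_sum, dotProduct, gradFailProb, mul_comm]

lemma continuous_gradFailProb {t : ℝ} (ht : 0 < t) (x : Fin (J + 1) → ℝ) :
    Continuous (gradFailProb t x) := by
  refine continuous_pi fun s => ?_
  exact ((contDiff_failProb ht x).continuous_fderiv (by simp)).clm_apply continuous_const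

/-- The gradient of the failure probability. -/
lemma gradFailProb_eq {t : ℝ} (ht : 0 < t) (x : Fin (J + 1) → ℝ) (θ : Param J) :
    gradFailProb t x θ = (failProb t x θ * (1 - failProb t x θ)) •
      Sum.elim (fun j => -(shape x θ * x j))
        (fun j => Real.log (t / scale x θ) * (shape x θ * x j)) := by
  have h : failProb t x = fun θ : Param J => Real.sigmoid
      (Real.exp (shapeForm x θ) * (Real.log t - scaleForm x θ)) := by
    ext θ; exact failProb_eq_sigmoid ht x θ
  have hs : HasFDerivAt (fun θ => shapeForm x θ) (shapeForm x) θ := (shapeForm x).hasFDerivAt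
  have hc : HasFDerivAt (fun θ => scaleForm x θ) (scaleForm x) θ := (scaleForm x).hasFDerivAt
  have hf := hs.exp.mul (hc.const_sub (Real.log t))
  have hd := (Real.hasDerivAt_sigmoid
    (Real.exp (shapeForm x θ) * (Real.log t - scaleForm x θ))).comp_hasFDerivAt θ hf
  have hd' := hd.fderiv
  rw [show Real.sigmoid ∘ ((fun θ => Real.exp (shapeForm x θ)) *
    fun θ => Real.log t - scaleForm x θ) = failProb t x from h.symm] at hd'
  funext s
  rw [gradFailProb, hd', failProb_eq_sigmoid ht, Real.log_div ht.ne' (scale_pos x θ).ne',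
    scale_eq, shape_eq, Real.log_exp]
  have e1 : ∀ j, scaleForm x (EuclideanSpace.single (Sum.inl j) (1 : ℝ)) = x j := fun j => by
    simp [scaleForm_apply]
  have e2 : ∀ j, shapeForm x (EuclideanSpace.single (Sum.inr j) (1 : ℝ)) = x j := fun j => by
    simp [shapeForm_apply]
  have e3 : ∀ j, scaleForm x (EuclideanSpace.single (Sum.inr j) (1 : ℝ)) = 0 := fun j => by
    simp [scaleForm_apply]
  have e4 : ∀ j, shapeForm x (EuclideanSpace.single (Sum.inl j) (1 : ℝ)) = 0 := fun j => by
    simp [shapeForm_apply]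
  rcases s with j | j
  · simp [e1, e4]
  · simp [e2, e3]

/-- The weight `u ^ (γ - 1) + (1 - u) ^ (γ - 1)` of the density power divergence. -/
def powerWeight (γ u : ℝ) : ℝ := u ^ (γ - 1) + (1 - u) ^ (γ - 1)

lemma powerWeight_pos (γ : ℝ) {u : ℝ} (hu : u ∈ Set.Ioo (0 : ℝ) 1) : 0 < powerWeight γ u :=
  add_pos (Real.rpow_pos_of_pos hu.1 _) (Real.rpow_pos_of_pos (sub_pos.2 hu.2) _)

lemma continuousOn_powerWeight (γ : ℝ) : ContinuousOn (powerWeight γ) (Set.Ioo 0 1) := by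
  intro u hu
  refine ContinuousAt.continuousWithinAt ?_
  unfold powerWeight
  exact (Real.continuousAt_rpow_const _ _ (Or.inl hu.1.ne')).add
    (ContinuousAt.rpow_const (by fun_prop) (Or.inl (sub_pos.2 hu.2).ne'))

lemma failProb_mem_Ioo {t : ℝ} (ht : 0 < t) (x : Fin (J + 1) → ℝ) (θ : Param J) :
    failProb t x θ ∈ Set.Ioo (0 : ℝ) 1 := ⟨failProb_pos ht x θ, failProb_lt_one ht x θ⟩

/-- The weighted gradient of the failure probability. -/
def weightedGrad (γ t : ℝ) (x : Fin (J + 1) → ℝ) (θ : Param J) : Coord J → ℝ :=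
  powerWeight γ (failProb t x θ) • gradFailProb t x θ

lemma continuous_weightedGrad (γ : ℝ) {t : ℝ} (ht : 0 < t) (x : Fin (J + 1) → ℝ) :
    Continuous (weightedGrad γ t x) :=
  ((continuousOn_powerWeight γ).comp_continuous (contDiff_failProb ht x).continuous
    fun θ => failProb_mem_Ioo ht x θ).smul (continuous_gradFailProb ht x)

/-- The estimating function for real-valued device numbers and counts. -/
def score (γ : ℝ) (τ : Fin I → ℝ) (x : Fin I → Fin (J + 1) → ℝ) (k y : Fin I → ℝ)
    (θ : Param J) : Coord J → ℝ :=
  ∑ i, (k i * failProb (τ i) (x i) θ - y i) • weightedGrad γ (τ i) (x i) θ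

/-- With `F` the failure and `R` the survival probability, the gradient contributes a factor `F *
R`, and `F * R * (F ^ (γ - 1) + R ^ (γ - 1)) = F ^ γ * R + R ^ γ * F` is the fraction in `estFun`.
-/
lemma estFun_eq_score (γ : ℝ) {τ : Fin I → ℝ} (hτ : ∀ i, 0 < τ i)
    (x : Fin I → Fin (J + 1) → ℝ) (K n : Fin I → ℕ) (θ : Param J) :
    estFun γ τ x K n θ = score γ τ x (fun i => K i) (fun i => n i) θ := by
  unfold estFun score
  refine Finset.sum_congr rfl fun i _ => ?_
  rw [weightedGrad, gradFailProb_eq (hτ i), ← survProb_eq (hτ i), smul_smul, smul_smul]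
  congr 1
  rw [powerWeight, ← survProb_eq (hτ i)]
  simp only [failProb, survProb, logLogisticCDF, logLogisticReliability]
  have hX := Real.rpow_pos_of_pos (hτ i) (shape (x i) θ)
  have hY := Real.rpow_pos_of_pos (scale_pos (x i) θ) (shape (x i) θ)
  rw [mul_assoc]
  congr 1
  rw [Real.rpow_mul (hτ i).le, Real.rpow_mul (scale_pos (x i) θ).le]
  set X := τ i ^ shape (x i) θ
  set Y := scale (x i) θ ^ shape (x i) θ
  have hS : 0 < X + Y := by positivity
  rw [Real.rpow_sub_one (by positivity), Real.rpow_sub_one (by positivity),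
    Real.div_rpow hX.le hS.le, Real.div_rpow hY.le hS.le, Real.rpow_add_one hS.ne']
  have := Real.rpow_pos_of_pos hS γ
  field_simp

lemma score_smul (γ : ℝ) (τ : Fin I → ℝ) (x : Fin I → Fin (J + 1) → ℝ) (c : ℝ)
    (k y : Fin I → ℝ) (θ : Param J) :
    score γ τ x (c • k) (c • y) θ = c • score γ τ x k y θ := by
  simp only [score, Finset.smul_sum, smul_smul, Pi.smul_apply, smul_eq_mul]
  exact Finset.sum_congr rfl fun i _ => by ring_nf

/-- The asymmetric form is the one that appears when only the failure probability inside `score` is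
linearised and the weighted gradient is kept as a coefficient. -/
lemma matJ_eq (γ : ℝ) {τ : Fin I → ℝ} (hτ : ∀ i, 0 < τ i) (x : Fin I → Fin (J + 1) → ℝ)
    (w : Fin I → ℝ) (θ : Param J) :
    matJ γ τ x w θ = ∑ i, w i • Matrix.vecMulVec (weightedGrad γ (τ i) (x i) θ)
      (gradFailProb (τ i) (x i) θ) := by
  unfold matJ
  refine Finset.sum_congr rfl fun i _ => ?_
  rw [weightedGrad, Matrix.smul_vecMulVec, smul_smul, powerWeight, survProb_eq (hτ i)]

/-- This displays `matK` as a covariance: each device contributes the Bernoulli variance times the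
square of its coefficient in `score`. -/
lemma matK_eq (γ : ℝ) {τ : Fin I → ℝ} (hτ : ∀ i, 0 < τ i) (x : Fin I → Fin (J + 1) → ℝ)
    (w : Fin I → ℝ) (θ : Param J) :
    matK γ τ x w θ = ∑ i, (w i * (failProb (τ i) (x i) θ * (1 - failProb (τ i) (x i) θ))) •
      Matrix.vecMulVec (weightedGrad γ (τ i) (x i) θ) (weightedGrad γ (τ i) (x i) θ) := by
  unfold matK
  refine Finset.sum_congr rfl fun i _ => ?_
  rw [weightedGrad, Matrix.smul_vecMulVec, Matrix.vecMulVec_smul, smul_smul, smul_smul,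
    powerWeight, survProb_eq (hτ i)]
  congr 1
  ring

/-- The derivative of a restriction function in coordinates. -/
lemma fderiv_restr_apply (m : Param J → EuclideanSpace ℝ (Fin r)) (θ v : Param J) (l : Fin r) :
    fderiv ℝ m θ v l = ((restrMatrix m θ)ᵀ *ᵥ v) l := by
  conv_lhs => rw [← (EuclideanSpace.basisFun (Coord J) ℝ).sum_repr v]
  simp [map_sum, Matrix.mulVec, dotProduct, restrMatrix, mul_comm]

/-! ### Constrained minimisation

The constraint is differentiable near a point, with a derivative that is continuous at that point
only, so that the Lagrange multiplier rule at nearby points needs a local straightening of the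
constraint set around the given point. -/

section Constrained

variable {E F : Type*} [NormedAddCommGroup E] [NormedSpace ℝ E] [NormedAddCommGroup F]

/-- A Lagrange multiplier rule at all points near `a`. -/
theorem eventually_ker_le_of_isLocalMinOn [NormedSpace ℝ F] [FiniteDimensional ℝ E] {m : E → F} {a : E}
    (hd : ∀ᶠ θ in 𝓝 a, DifferentiableAt ℝ m θ) (hc : ContinuousAt (fderiv ℝ m) a)
    {s : F →L[ℝ] E} (hs : ∀ u, fderiv ℝ m a (s u) = u) :
    ∀ᶠ θ in 𝓝 a, ∀ (φ : E → ℝ) (φ' : E →L[ℝ] ℝ), HasFDerivAt φ φ' θ →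
      IsLocalMinOn φ {z | m z = m θ} θ → ∀ v, fderiv ℝ m θ v = 0 → φ' v = 0 := by
  set A := fderiv ℝ m a with hA
  have hm : HasStrictFDerivAt m A a :=
    hasStrictFDerivAt_of_hasFDerivAt_of_continuousAt (hd.mono fun _ h => h.hasFDerivAt) hc
  -- `Φ` has derivative the identity at `a` and satisfies `A ∘ Φ = m`, so near `a` it carries level
  -- sets of `m` to affine subspaces parallel to the kernel of `A`.
  let Φ : E → E := fun θ => θ + s (m θ - A θ)
  have hΦ : ∀ θ, DifferentiableAt ℝ m θ → HasFDerivAt Φ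
      (ContinuousLinearMap.id ℝ E + s.comp (fderiv ℝ m θ - A)) θ := fun θ h =>
    (hasFDerivAt_id θ).add (s.hasFDerivAt.comp θ (h.hasFDerivAt.sub A.hasFDerivAt))
  have hΦa : HasStrictFDerivAt Φ ((ContinuousLinearEquiv.refl ℝ E : E ≃L[ℝ] E) : E →L[ℝ] E) a := by
    have := (hasStrictFDerivAt_id (𝕜 := ℝ) a).add
      (s.hasStrictFDerivAt.comp a (hm.sub A.hasStrictFDerivAt))
    convert! this using 1
    ext; simp
  have hAΦ : ∀ θ, A (Φ θ) = m θ := fun θ => by simp [Φ, hs]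
  let e := hΦa.toOpenPartialHomeomorph Φ
  have hsrc : ∀ᶠ θ in 𝓝 a, θ ∈ e.source :=
    e.open_source.mem_nhds hΦa.mem_toOpenPartialHomeomorph_source
  -- The derivative of `Φ` is continuous at `a` only; as the invertible maps form an open set, this
  -- already gives invertibility at all nearby points.
  have hinv : ∀ᶠ θ in 𝓝 a, ∃ L : E ≃L[ℝ] E,
      (L : E →L[ℝ] E) = ContinuousLinearMap.id ℝ E + s.comp (fderiv ℝ m θ - A) := by
    have hcont : ContinuousAt
        (fun θ => ContinuousLinearMap.id ℝ E + s.comp (fderiv ℝ m θ - A)) a := by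
      refine continuousAt_const.add ?_
      exact ((ContinuousLinearMap.compL ℝ E F E s).continuous.continuousAt).comp
        (hc.sub continuousAt_const)
    have h1 := hcont.eventually_mem (s := Set.range
      ((↑) : (E ≃L[ℝ] E) → E →L[ℝ] E)) (by
        have := ContinuousLinearEquiv.nhds (𝕜 := ℝ) (ContinuousLinearEquiv.refl ℝ E)
        convert! this using 2
        ext; simp [hA])
    filter_upwards [h1] with θ h
    exact h
  filter_upwards [hd, hsrc, hinv] with θ hdθ hsθ ⟨L, hL⟩ φ φ' hφ hmin v hv
  have hLv : A (L v) = 0 := by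
    have : L v = v + s (fderiv ℝ m θ v - A v) := by
      have := congrArg (fun T : E →L[ℝ] E => T v) hL
      simpa using this
    rw [this, map_add, hs, hv]; simp
  have he : (e : E → E) = Φ := hΦa.toOpenPartialHomeomorph_coe
  have htgt : Φ θ ∈ e.target := by rw [← he]; exact e.map_source hsθ
  have hsymm : e.symm (Φ θ) = θ := by rw [← he]; exact e.left_inv hsθ
  have hder : HasFDerivAt e.symm (L.symm : E →L[ℝ] E) (Φ θ) := by
    refine e.hasFDerivAt_symm htgt ?_
    rw [hsymm, he, hL]
    exact hΦ θ hdθ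
  -- Pulling back the line in direction `L v`, which lies in the kernel of `A`, gives a curve inside
  -- the level set of `m` through `θ` with velocity `v`.
  let c : ℝ → E := fun t => e.symm (Φ θ + t • L v)
  have hline : HasDerivAt (fun t : ℝ => Φ θ + t • L v) (L v) 0 := by
    simpa using ((hasDerivAt_id (0 : ℝ)).smul_const (L v)).const_add (Φ θ)
  have hc0 : c 0 = θ := by simp [c, hsymm]
  have hcd : HasDerivAt c v 0 := by
    have h0 : HasFDerivAt e.symm (L.symm : E →L[ℝ] E) (Φ θ + (0 : ℝ) • L v) := by simpa using hder
    have := h0.comp_hasDerivAt (0 : ℝ) hline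
    rwa [ContinuousLinearEquiv.coe_coe, L.symm_apply_apply] at this
  have hφc : HasDerivAt (φ ∘ c) (φ' v) 0 :=
    HasFDerivAt.comp_hasDerivAt (0 : ℝ) (by rwa [hc0]) hcd
  have hmc : ∀ᶠ t in 𝓝 (0 : ℝ), m (c t) = m θ := by
    have hl : Tendsto (fun t : ℝ => Φ θ + t • L v) (𝓝 0) (𝓝 (Φ θ)) := by
      have := hline.continuousAt.tendsto
      simpa using this
    filter_upwards [hl.eventually (e.open_target.mem_nhds htgt)] with t ht
    have h1 : Φ (c t) = Φ θ + t • L v := by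
      rw [← he]; rw [he]; exact he ▸ e.right_inv ht
    rw [← hAΦ (c t), h1, map_add, map_smul, hLv, hAΦ]; simp
  have hlm : IsLocalMin (φ ∘ c) 0 := by
    have h1 : Tendsto c (𝓝 0) (𝓝[{z | m z = m θ}] θ) := by
      refine tendsto_nhdsWithin_iff.2 ⟨?_, hmc⟩
      have := hcd.continuousAt.tendsto
      rwa [hc0] at this
    have h2 := h1.eventually hmin
    filter_upwards [h2] with t ht
    simpa [hc0] using ht
  exact hlm.hasDerivAt_eq_zero hφc

/-- A strict constrained local minimiser persists under perturbation of the objective. -/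
theorem eventually_exists_isLocalMinOn [FiniteDimensional ℝ E] {X : Type*} [TopologicalSpace X]
    {m : E → F} {a : E} {H : X → E → ℝ} {x₀ : X}
    (hm : ∀ᶠ θ in 𝓝 a, ContinuousAt m θ) (hH : Continuous fun p : X × E => H p.1 p.2)
    (hmin : ∀ᶠ θ in 𝓝[≠] a, H x₀ a < H x₀ θ) {U : Set E} (hU : U ∈ 𝓝 a) :
    ∀ᶠ x in 𝓝 x₀, ∃ θ ∈ U, m θ = m a ∧ IsLocalMinOn (H x) {z | m z = m a} θ := by
  rw [eventually_nhdsWithin_iff] at hmin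
  obtain ⟨ρ, hρ, hball⟩ := Metric.nhds_basis_closedBall.mem_iff.1 (inter_mem (inter_mem hm hmin) hU)
  have hmc : ContinuousOn m (Metric.closedBall a ρ) :=
    fun θ hθ => (hball hθ).1.1.continuousWithinAt
  have hproper : ProperSpace E := FiniteDimensional.proper ℝ E
  -- The strict inequality on the sphere is an open condition in the parameter, uniformly by
  -- compactness of the sphere.
  have hsph : ∀ᶠ x in 𝓝 x₀, ∀ θ ∈ Metric.sphere a ρ, H x a < H x θ := by
    refine (isCompact_sphere a ρ).eventually_forall_of_forall_eventually fun θ hθ => ?_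
    have h0 : H x₀ a < H x₀ θ :=
      (hball (Metric.sphere_subset_closedBall hθ)).1.2 (Metric.ne_of_mem_sphere hθ hρ.ne')
    have h1 : Continuous fun z : X × E => H z.1 a :=
      hH.comp (continuous_fst.prodMk continuous_const)
    exact (h1.tendsto (x₀, θ)).eventually_lt (hH.tendsto (x₀, θ)) h0
  filter_upwards [hsph] with x hx
  have hcomp : IsCompact (Metric.closedBall a ρ ∩ m ⁻¹' {m a}) := by
    refine (isCompact_closedBall a ρ).of_isClosed_subset ?_ Set.inter_subset_left
    exact hmc.preimage_isClosed_of_isClosed Metric.isClosed_closedBall isClosed_singleton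
  have ha : a ∈ Metric.closedBall a ρ ∩ m ⁻¹' {m a} :=
    ⟨Metric.mem_closedBall_self hρ.le, rfl⟩
  obtain ⟨θ, hθ, hθmin⟩ := hcomp.exists_isMinOn ⟨a, ha⟩
    (hH.comp (continuous_const.prodMk continuous_id) : Continuous (H x)).continuousOn
  refine ⟨θ, (hball hθ.1).2, hθ.2, ?_⟩
  -- The centre `a` is feasible and beats every point of the sphere, so the minimiser over the
  -- closed ball lies in its interior.
  have hlt : dist θ a < ρ := by
    refine lt_of_le_of_ne hθ.1 fun h => ?_
    exact absurd (hx θ h) (not_lt.2 (hθmin ha))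
  have : Metric.ball a ρ ∈ 𝓝 θ := Metric.isOpen_ball.mem_nhds hlt
  filter_upwards [mem_nhdsWithin_of_mem_nhds this, self_mem_nhdsWithin] with z hz hz'
  exact hθmin ⟨Metric.ball_subset_closedBall hz, hz'⟩

end Constrained

/-! ### The restriction matrix -/

lemma mulVec_injective_of_rank_eq {ι : Type*} [Fintype ι] {M : Matrix ι (Fin r) ℝ}
    (h : M.rank = r) : Function.Injective M.mulVec := by
  have h1 := LinearMap.finrank_range_add_finrank_ker M.mulVecLin
  rw [← Matrix.rank, h, Module.finrank_pi, Fintype.card_fin] at h1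
  have h2 : LinearMap.ker M.mulVecLin = ⊥ := Submodule.finrank_eq_zero.1 (by omega)
  exact LinearMap.ker_eq_bot.1 h2

lemma transpose_mulVec_surjective_of_rank_eq {ι : Type*} [Fintype ι] {M : Matrix ι (Fin r) ℝ}
    (h : M.rank = r) : Function.Surjective Mᵀ.mulVec := by
  have h1 : LinearMap.range Mᵀ.mulVecLin = ⊤ := by
    apply Submodule.eq_top_of_finrank_eq
    rw [← Matrix.rank, Matrix.rank_transpose, h, Module.finrank_pi, Fintype.card_fin]
  exact LinearMap.range_eq_top.1 h1

lemma continuousAt_fderiv_of_restrMatrix {m : Param J → EuclideanSpace ℝ (Fin r)} {θ₀ : Param J}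
    (hm : ContinuousAt (restrMatrix m) θ₀) : ContinuousAt (fderiv ℝ m) θ₀ := by
  let T : Matrix (Coord J) (Fin r) ℝ →ₗ[ℝ] (Param J →L[ℝ] EuclideanSpace ℝ (Fin r)) :=
    (LinearMap.toContinuousLinearMap (𝕜 := ℝ) (E := Param J)
      (F' := EuclideanSpace ℝ (Fin r))).toLinearMap ∘ₗ
    (Matrix.toEuclideanLin (𝕜 := ℝ)).toLinearMap ∘ₗ
    (Matrix.transposeLinearEquiv (Coord J) (Fin r) ℝ ℝ).toLinearMap
  have hT : Continuous T := T.continuous_of_finiteDimensional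
  have h : fderiv ℝ m = T ∘ restrMatrix m := by
    ext θ v l
    rw [fderiv_restr_apply]
    rfl
  rw [h]
  exact hT.continuousAt.comp hm

/-- A linear form vanishing on the kernel of the derivative of the restrictions is a combination
of the columns of the restriction matrix. -/
lemma exists_restrMatrix_mulVec_eq (m : Param J → EuclideanSpace ℝ (Fin r)) (θ : Param J)
    {u : Coord J → ℝ} (hu : ∀ v : Param J, fderiv ℝ m θ v = 0 → u ⬝ᵥ v = 0) :
    ∃ lam, u + restrMatrix m θ *ᵥ lam = 0 := by
  let φ : Module.Dual ℝ (Param J) :=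
    (dotProductBilin ℝ ℝ u : (Coord J → ℝ) →ₗ[ℝ] ℝ) ∘ₗ
      (WithLp.linearEquiv 2 ℝ (Coord J → ℝ)).toLinearMap
  have hφ : ∀ v, φ v = u ⬝ᵥ v := fun v => rfl
  have h1 : φ ∈ (LinearMap.ker (fderiv ℝ m θ).toLinearMap).dualAnnihilator := by
    rw [Submodule.mem_dualAnnihilator]
    exact fun v hv => hu v hv
  -- A functional vanishing on the kernel factors through the derivative; the coordinates of the
  -- factor, negated, are the multipliers.
  rw [← LinearMap.range_dualMap_eq_dualAnnihilator_ker] at h1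
  obtain ⟨ψ, hψ⟩ := h1
  refine ⟨fun l => -ψ (EuclideanSpace.single l 1), ?_⟩
  funext s
  have h2 : u s = ψ (fderiv ℝ m θ (EuclideanSpace.single s 1)) := by
    have := congrArg (fun f => f (EuclideanSpace.single s (1 : ℝ))) hψ
    simp only [hφ] at this
    simpa using this.symm
  have h3 : fderiv ℝ m θ (EuclideanSpace.single s 1) =
      ∑ l, restrMatrix m θ s l • EuclideanSpace.single l (1 : ℝ) := by
    rw [← (EuclideanSpace.basisFun (Fin r) ℝ).sum_repr
      (fderiv ℝ m θ (EuclideanSpace.single s 1))]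
    simp [restrMatrix]
  simp [h2, h3, Matrix.mulVec, dotProduct]

/-! ### Existence of roots -/

/-- The weighted power integral `∫ t ^ d (t ^ (γ - 1) + (1 - t) ^ (γ - 1)) dt` from `u₀` to `u`. -/
def powerIntegral (γ : ℝ) (d : ℕ) (u₀ u : ℝ) : ℝ := ∫ t in u₀..u, t ^ d * powerWeight γ t

lemma continuousOn_pow_mul_powerWeight (γ : ℝ) (d : ℕ) :
    ContinuousOn (fun t => t ^ d * powerWeight γ t) (Set.Ioo 0 1) :=
  (continuous_pow d).continuousOn.mul (continuousOn_powerWeight γ)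

lemma intervalIntegrable_pow_mul_powerWeight (γ : ℝ) (d : ℕ) {u v : ℝ}
    (hu : u ∈ Set.Ioo (0 : ℝ) 1) (hv : v ∈ Set.Ioo (0 : ℝ) 1) :
    IntervalIntegrable (fun t => t ^ d * powerWeight γ t) volume u v :=
  ((continuousOn_pow_mul_powerWeight γ d).mono
    (Set.ordConnected_Ioo.uIcc_subset hu hv)).intervalIntegrable

lemma hasDerivAt_powerIntegral (γ : ℝ) (d : ℕ) {u₀ u : ℝ} (hu₀ : u₀ ∈ Set.Ioo (0 : ℝ) 1)
    (hu : u ∈ Set.Ioo (0 : ℝ) 1) :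
    HasDerivAt (powerIntegral γ d u₀) (u ^ d * powerWeight γ u) u :=
  intervalIntegral.integral_hasDerivAt_right
    (intervalIntegrable_pow_mul_powerWeight γ d hu₀ hu)
    ((continuousOn_pow_mul_powerWeight γ d).stronglyMeasurableAtFilter isOpen_Ioo u hu)
    ((continuousOn_pow_mul_powerWeight γ d).continuousAt (isOpen_Ioo.mem_nhds hu))

/-- The difference is the integral of `(t - u₀) * powerWeight γ t` from `u₀` to `u`, whose integrand
and orientation change sign together at `u₀`. This is the strict minimality of the divergence in one
dimension. -/
lemma powerIntegral_sub_pos (γ : ℝ) {u₀ u : ℝ} (hu₀ : u₀ ∈ Set.Ioo (0 : ℝ) 1)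
    (hu : u ∈ Set.Ioo (0 : ℝ) 1) (hne : u ≠ u₀) :
    0 < powerIntegral γ 1 u₀ u - u₀ * powerIntegral γ 0 u₀ u := by
  have hi1 := intervalIntegrable_pow_mul_powerWeight γ 1 hu₀ hu
  have hi0 := (intervalIntegrable_pow_mul_powerWeight γ 0 hu₀ hu).const_mul u₀
  have h : powerIntegral γ 1 u₀ u - u₀ * powerIntegral γ 0 u₀ u =
      ∫ t in u₀..u, (t - u₀) * powerWeight γ t := by
    rw [powerIntegral, powerIntegral, ← intervalIntegral.integral_const_mul,
      ← intervalIntegral.integral_sub hi1 hi0]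
    congr 1; ext t; ring
  have hi : IntervalIntegrable (fun t => (t - u₀) * powerWeight γ t) volume u₀ u := by
    refine (hi1.sub hi0).congr fun t _ => ?_
    ring
  rw [h]
  rcases lt_or_gt_of_ne hne with hlt | hlt
  · rw [intervalIntegral.integral_symm, ← intervalIntegral.integral_neg]
    refine intervalIntegral.intervalIntegral_pos_of_pos_on hi.symm.neg (fun t ht => ?_) hlt
    have := powerWeight_pos γ (u := t) ⟨hu.1.trans ht.1, ht.2.trans hu₀.2⟩
    rw [← neg_mul]
    exact mul_pos (by linarith [ht.2]) this
  · refine intervalIntegral.intervalIntegral_pos_of_pos_on hi (fun t ht => ?_) hlt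
    have := powerWeight_pos γ (u := t) ⟨hu₀.1.trans ht.1, ht.2.trans hu.2⟩
    exact mul_pos (by linarith [ht.1]) this

/-- A primitive of the estimating function, for real-valued device numbers and counts. -/
def potential (γ : ℝ) (τ : Fin I → ℝ) (x : Fin I → Fin (J + 1) → ℝ) (θ₀ : Param J)
    (p : (Fin I → ℝ) × (Fin I → ℝ)) (θ : Param J) : ℝ :=
  ∑ i, (p.1 i * powerIntegral γ 1 (failProb (τ i) (x i) θ₀) (failProb (τ i) (x i) θ) -
    p.2 i * powerIntegral γ 0 (failProb (τ i) (x i) θ₀) (failProb (τ i) (x i) θ))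

lemma hasFDerivAt_potential (γ : ℝ) {τ : Fin I → ℝ} (hτ : ∀ i, 0 < τ i)
    (x : Fin I → Fin (J + 1) → ℝ) (θ₀ : Param J) (p : (Fin I → ℝ) × (Fin I → ℝ)) (θ : Param J) :
    ∃ φ' : Param J →L[ℝ] ℝ, HasFDerivAt (potential γ τ x θ₀ p) φ' θ ∧
      ∀ v : Param J, φ' v = score γ τ x p.1 p.2 θ ⬝ᵥ v := by
  have hd : ∀ i, ∀ d : ℕ, HasFDerivAt (fun θ => powerIntegral γ d (failProb (τ i) (x i) θ₀)
      (failProb (τ i) (x i) θ)) ((failProb (τ i) (x i) θ ^ d *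
        powerWeight γ (failProb (τ i) (x i) θ)) • fderiv ℝ (failProb (τ i) (x i)) θ) θ :=
    fun i d => (hasDerivAt_powerIntegral γ d (failProb_mem_Ioo (hτ i) (x i) θ₀)
      (failProb_mem_Ioo (hτ i) (x i) θ)).comp_hasFDerivAt θ
      (((contDiff_failProb (hτ i) (x i)).differentiable (by simp)) θ).hasFDerivAt
  refine ⟨_, HasFDerivAt.fun_sum fun i _ =>
    ((hd i 1).const_mul (p.1 i)).sub ((hd i 0).const_mul (p.2 i)), fun v => ?_⟩
  simp only [_root_.sum_apply, score, sum_dotProduct, smul_dotProduct, weightedGrad,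
    gradFailProb_dotProduct]
  refine Finset.sum_congr rfl fun i _ => ?_
  simp
  ring

lemma continuous_potential (γ : ℝ) {τ : Fin I → ℝ} (hτ : ∀ i, 0 < τ i)
    (x : Fin I → Fin (J + 1) → ℝ) (θ₀ : Param J) :
    Continuous fun q : ((Fin I → ℝ) × (Fin I → ℝ)) × Param J => potential γ τ x θ₀ q.1 q.2 := by
  have hd : ∀ i, ∀ d : ℕ, Continuous (fun θ => powerIntegral γ d (failProb (τ i) (x i) θ₀)
      (failProb (τ i) (x i) θ)) := fun i d => by
    have : ContinuousOn (powerIntegral γ d (failProb (τ i) (x i) θ₀)) (Set.Ioo 0 1) :=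
      fun u hu => (hasDerivAt_powerIntegral γ d (failProb_mem_Ioo (hτ i) (x i) θ₀)
        hu).continuousAt.continuousWithinAt
    exact this.comp_continuous (contDiff_failProb (hτ i) (x i)).continuous
      fun θ => failProb_mem_Ioo (hτ i) (x i) θ
  unfold potential
  refine continuous_finsetSum _ fun i _ => ?_
  have h1 := (hd i 1).comp (continuous_snd (X := (Fin I → ℝ) × (Fin I → ℝ)))
  have h0 := (hd i 0).comp (continuous_snd (X := (Fin I → ℝ) × (Fin I → ℝ)))
  simp only [Function.comp_def] at h0 h1
  fun_prop

/-- At the limiting failure frequencies the true parameter is a strict local minimiser. -/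
lemma eventually_potential_lt (γ : ℝ) {τ : Fin I → ℝ} (hτ : ∀ i, 0 < τ i)
    (x : Fin I → Fin (J + 1) → ℝ) {w : Fin I → ℝ} (hw : ∀ i, 0 ≤ w i) {θ₀ : Param J}
    (hJ : IsUnit (matJ γ τ x w θ₀).det) :
    ∀ᶠ θ in 𝓝[≠] θ₀,
      potential γ τ x θ₀ (w, fun i => w i * failProb (τ i) (x i) θ₀) θ₀ <
      potential γ τ x θ₀ (w, fun i => w i * failProb (τ i) (x i) θ₀) θ := by
  let f : Param J → Fin I → ℝ := fun θ i => w i * failProb (τ i) (x i) θ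
  let f' : Param J →L[ℝ] (Fin I → ℝ) :=
    ContinuousLinearMap.pi fun i => w i • fderiv ℝ (failProb (τ i) (x i)) θ₀
  have hf : HasFDerivAt f f' θ₀ := hasFDerivAt_pi.2 fun i =>
    (((contDiff_failProb (hτ i) (x i)).differentiable (by simp)) θ₀).hasFDerivAt.const_mul (w i)
  -- A direction in the kernel of `f'` is killed by every summand of `matJ`, hence is zero; so `f`
  -- separates `θ₀` from all nearby points.
  have hker : LinearMap.ker f'.toLinearMap = ⊥ := by
    refine LinearMap.ker_eq_bot'.2 fun v hv => ?_
    have h1 : ∀ i, w i * (gradFailProb (τ i) (x i) θ₀ ⬝ᵥ v) = 0 := fun i => by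
      rw [gradFailProb_dotProduct]
      exact congrFun hv i
    have h2 : matJ γ τ x w θ₀ *ᵥ v = 0 := by
      rw [matJ_eq γ hτ, Matrix.sum_mulVec]
      refine Finset.sum_eq_zero fun i _ => ?_
      rw [Matrix.smul_mulVec, Matrix.vecMulVec_mulVec]
      ext s
      have := h1 i
      simp only [Pi.smul_apply, smul_eq_mul, MulOpposite.smul_eq_mul_unop, MulOpposite.unop_op,
        Pi.zero_apply]
      linear_combination (weightedGrad γ (τ i) (x i) θ₀ s) * this
    have h3 := (Matrix.mulVec_injective_iff_isUnit.2 ((Matrix.isUnit_iff_isUnit_det _).2 hJ))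
      (h2.trans (Matrix.mulVec_zero _).symm)
    ext s
    exact congrFun h3 s
  obtain ⟨C, -, hC⟩ := f'.toLinearMap.exists_antilipschitzWith hker
  filter_upwards [hf.eventually_ne (c := f θ₀) ⟨C, hC⟩] with θ hθ
  have h0 : potential γ τ x θ₀ (w, fun i => w i * failProb (τ i) (x i) θ₀) θ₀ = 0 := by
    simp [potential, powerIntegral]
  have hterm : ∀ i, w i * powerIntegral γ 1 (failProb (τ i) (x i) θ₀) (failProb (τ i) (x i) θ) -
      w i * failProb (τ i) (x i) θ₀ *
        powerIntegral γ 0 (failProb (τ i) (x i) θ₀) (failProb (τ i) (x i) θ) =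
      w i * (powerIntegral γ 1 (failProb (τ i) (x i) θ₀) (failProb (τ i) (x i) θ) -
        failProb (τ i) (x i) θ₀ *
          powerIntegral γ 0 (failProb (τ i) (x i) θ₀) (failProb (τ i) (x i) θ)) := fun i => by ring
  -- One condition of positive weight has a changed failure probability and contributes strictly;
  -- all others contribute nonnegatively.
  obtain ⟨i, hi⟩ := Function.ne_iff.1 hθ
  have hi' : w i ≠ 0 ∧ failProb (τ i) (x i) θ ≠ failProb (τ i) (x i) θ₀ := by
    constructor
    · rintro h; exact hi (by simp [f, h])
    · rintro h; exact hi (by simp [f, h])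
  rw [h0, potential]
  simp only [hterm]
  refine Finset.sum_pos' (fun j _ => mul_nonneg (hw j) ?_) ⟨i, Finset.mem_univ i,
    mul_pos ((hw i).lt_of_ne' hi'.1) (powerIntegral_sub_pos γ (failProb_mem_Ioo (hτ i) (x i) θ₀)
      (failProb_mem_Ioo (hτ i) (x i) θ) hi'.2)⟩
  by_cases h : failProb (τ j) (x j) θ = failProb (τ j) (x j) θ₀
  · simp [h, powerIntegral]
  · exact (powerIntegral_sub_pos γ (failProb_mem_Ioo (hτ j) (x j) θ₀)
      (failProb_mem_Ioo (hτ j) (x j) θ) h).le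

/-- If the device proportions and failure frequencies are close to their limits, the restricted
estimating equations have a root close to the true parameter. -/
theorem eventually_exists_root (γ : ℝ) {τ : Fin I → ℝ} (hτ : ∀ i, 0 < τ i)
    (x : Fin I → Fin (J + 1) → ℝ) {w : Fin I → ℝ} (hw : ∀ i, 0 ≤ w i)
    {m : Param J → EuclideanSpace ℝ (Fin r)} {θ₀ : Param J} (hm₀ : m θ₀ = 0)
    (hm_diff : ∀ᶠ θ in 𝓝 θ₀, DifferentiableAt ℝ m θ)
    (hm_cont : ContinuousAt (restrMatrix m) θ₀) (hm_rank : (restrMatrix m θ₀).rank = r)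
    (hJ : IsUnit (matJ γ τ x w θ₀).det) {U : Set (Param J)} (hU : U ∈ 𝓝 θ₀) :
    ∀ᶠ p in 𝓝 (w, fun i => w i * failProb (τ i) (x i) θ₀), ∃ θ ∈ U,
      (∃ lam, score γ τ x p.1 p.2 θ + restrMatrix m θ *ᵥ lam = 0) ∧ m θ = 0 := by
  have hsurj : (fderiv ℝ m θ₀).toLinearMap.range = ⊤ := by
    refine LinearMap.range_eq_top.2 fun u => ?_
    obtain ⟨v, hv⟩ := transpose_mulVec_surjective_of_rank_eq hm_rank u
    refine ⟨WithLp.toLp 2 v, ?_⟩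
    ext l
    exact (fderiv_restr_apply m θ₀ _ l).trans (congrFun hv l)
  obtain ⟨s, hs⟩ := (fderiv ℝ m θ₀).exists_rightInverse_of_surjective hsurj
  have hlag := eventually_ker_le_of_isLocalMinOn hm_diff (continuousAt_fderiv_of_restrMatrix hm_cont)
    (s := s) fun u => congrArg (fun T => T u) hs
  filter_upwards [eventually_exists_isLocalMinOn (hm_diff.mono fun θ h => h.continuousAt)
    (continuous_potential γ hτ x θ₀) (eventually_potential_lt γ hτ x hw hJ)
    (inter_mem hU hlag)] with p ⟨θ, ⟨hθU, hθ⟩, hmθ, hmin⟩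
  obtain ⟨φ', hφ, hφ'⟩ := hasFDerivAt_potential γ hτ x θ₀ p θ
  refine ⟨θ, hθU, exists_restrMatrix_mulVec_eq m θ fun v hv => ?_, hmθ.trans hm₀⟩
  rw [← hφ']
  exact hθ _ φ' hφ (by rwa [hmθ]) v hv

/-! ### The matrices of the asymptotic distribution -/

lemma matJ_posSemidef (γ : ℝ) {τ : Fin I → ℝ} (hτ : ∀ i, 0 < τ i) (x : Fin I → Fin (J + 1) → ℝ)
    {w : Fin I → ℝ} (hw : ∀ i, 0 ≤ w i) (θ : Param J) : (matJ γ τ x w θ).PosSemidef := by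
  unfold matJ
  refine Matrix.posSemidef_sum _ fun i _ => ?_
  refine Matrix.PosSemidef.smul ?_ (mul_nonneg (hw i) ?_)
  · simpa using Matrix.posSemidef_vecMulVec_self_star (gradFailProb (τ i) (x i) θ)
  · have := powerWeight_pos γ (failProb_mem_Ioo (hτ i) (x i) θ)
    rw [survProb_eq (hτ i)]
    exact this.le

lemma matK_posSemidef (γ : ℝ) {τ : Fin I → ℝ} (hτ : ∀ i, 0 < τ i) (x : Fin I → Fin (J + 1) → ℝ)
    {w : Fin I → ℝ} (hw : ∀ i, 0 ≤ w i) (θ : Param J) : (matK γ τ x w θ).PosSemidef := by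
  rw [matK_eq γ hτ]
  refine Matrix.posSemidef_sum _ fun i _ => ?_
  refine Matrix.PosSemidef.smul ?_ (mul_nonneg (hw i) ?_)
  · simpa using Matrix.posSemidef_vecMulVec_self_star (weightedGrad γ (τ i) (x i) θ)
  · have := failProb_mem_Ioo (hτ i) (x i) θ
    exact mul_nonneg this.1.le (sub_nonneg.2 this.2.le)

lemma transpose_matP {𝒥 : Matrix (Coord J) (Coord J) ℝ} (h : 𝒥.IsSymm)
    (M : Matrix (Coord J) (Fin r) ℝ) : (matP 𝒥 M)ᵀ = matP 𝒥 M := by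
  have h1 : (𝒥⁻¹)ᵀ = 𝒥⁻¹ := by rw [Matrix.transpose_nonsing_inv, h.eq]
  simp only [matP, matQ, Matrix.transpose_sub, Matrix.transpose_mul, Matrix.transpose_nonsing_inv,
    Matrix.transpose_transpose, h.eq, Matrix.mul_assoc]

/-- Multiplying the estimating equations by `matP` thus removes the unknown multipliers. -/
lemma matP_mul_restr {𝒥 : Matrix (Coord J) (Coord J) ℝ} {M : Matrix (Coord J) (Fin r) ℝ}
    (h : IsUnit (Mᵀ * 𝒥⁻¹ * M).det) : matP 𝒥 M * M = 0 := by
  rw [matP, matQ, Matrix.sub_mul]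
  have : 𝒥⁻¹ * M * (Mᵀ * 𝒥⁻¹ * M)⁻¹ * Mᵀ * 𝒥⁻¹ * M =
      𝒥⁻¹ * M * ((Mᵀ * 𝒥⁻¹ * M)⁻¹ * (Mᵀ * 𝒥⁻¹ * M)) := by
    simp only [Matrix.mul_assoc]
  rw [this, Matrix.nonsing_inv_mul _ h, Matrix.mul_one, sub_self]

/-- This splits a displacement into the part determined by the estimating equations and the part `Mᵀ
d`, which is negligible along the constraint set. -/
lemma matP_mul_add {𝒥 : Matrix (Coord J) (Coord J) ℝ} (h : IsUnit 𝒥.det)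
    (M : Matrix (Coord J) (Fin r) ℝ) : matP 𝒥 M * 𝒥 + matQ 𝒥 M * Mᵀ = 1 := by
  rw [matP, Matrix.sub_mul, Matrix.nonsing_inv_mul _ h, Matrix.mul_assoc,
    Matrix.nonsing_inv_mul _ h, Matrix.mul_one, sub_add_cancel]

lemma isUnit_det_restr {𝒥 : Matrix (Coord J) (Coord J) ℝ} (h : 𝒥.PosDef)
    {M : Matrix (Coord J) (Fin r) ℝ} (hM : M.rank = r) : IsUnit (Mᵀ * 𝒥⁻¹ * M).det := by
  have := h.inv.conjTranspose_mul_mul_same (mulVec_injective_of_rank_eq hM)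
  rw [Matrix.conjTranspose_eq_transpose_of_trivial] at this
  exact this.det_pos.ne'.isUnit

/-- Needed because the multipliers are eliminated with the restriction matrix at the root, while the
limit uses the one at `θ₀`. -/
lemma continuousAt_matP {𝒥 : Matrix (Coord J) (Coord J) ℝ} {M : Matrix (Coord J) (Fin r) ℝ}
    (h : IsUnit (Mᵀ * 𝒥⁻¹ * M).det) : ContinuousAt (matP 𝒥) M := by
  have hinv : ContinuousAt (fun N : Matrix (Coord J) (Fin r) ℝ => (Nᵀ * 𝒥⁻¹ * N)⁻¹) M := by
    have h1 : ContinuousAt Inv.inv (Mᵀ * 𝒥⁻¹ * M) := by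
      refine continuousAt_matrix_inv _ ?_
      rw [Ring.inverse_eq_inv']
      exact continuousAt_inv₀ h.ne_zero
    have h2 : Continuous fun N : Matrix (Coord J) (Fin r) ℝ => Nᵀ * 𝒥⁻¹ * N := by fun_prop
    exact ContinuousAt.comp (g := Inv.inv) h1 h2.continuousAt
  have h3 : Continuous fun p : Matrix (Coord J) (Fin r) ℝ × Matrix (Fin r) (Fin r) ℝ =>
      𝒥⁻¹ - 𝒥⁻¹ * p.1 * p.2 * p.1ᵀ * 𝒥⁻¹ := by fun_prop
  have h4 : Tendsto (fun N : Matrix (Coord J) (Fin r) ℝ => (N, (Nᵀ * 𝒥⁻¹ * N)⁻¹)) (𝓝 M)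
      (𝓝 (M, (Mᵀ * 𝒥⁻¹ * M)⁻¹)) := tendsto_id.prodMk_nhds hinv
  have h5 := (h3.tendsto (M, (Mᵀ * 𝒥⁻¹ * M)⁻¹)).comp h4
  have h6 : matP 𝒥 = (fun p : Matrix (Coord J) (Fin r) ℝ × Matrix (Fin r) (Fin r) ℝ =>
      𝒥⁻¹ - 𝒥⁻¹ * p.1 * p.2 * p.1ᵀ * 𝒥⁻¹) ∘ fun N => (N, (Nᵀ * 𝒥⁻¹ * N)⁻¹) := by
    funext N
    rw [matP, matQ, Function.comp_apply]
  rw [ContinuousAt, h6]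
  exact h5

/-! ### Linearisation of the estimating equations -/

/-- The coefficient of the centred failure frequency under condition `i` in the leading term of a
root. -/
def leadingTerm (γ : ℝ) (τ : Fin I → ℝ) (x : Fin I → Fin (J + 1) → ℝ) (w : Fin I → ℝ)
    (m : Param J → EuclideanSpace ℝ (Fin r)) (θ : Param J) (i : Fin I) : Param J :=
  WithLp.toLp 2 (matP (matJ γ τ x w θ) (restrMatrix m θ) *ᵥ weightedGrad γ (τ i) (x i) θ)

lemma isBigO_apply_euclidean {α ι : Type*} [Fintype ι] {l : Filter α}
    (f : α → EuclideanSpace ℝ ι) (s : ι) : (fun a => f a s) =O[l] f :=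
  IsBigO.of_bound 1 (Eventually.of_forall fun a => by
    rw [one_mul]; exact PiLp.norm_apply_le (f a) s)

lemma isLittleO_euclidean {α ι G : Type*} [Fintype ι] [NormedAddCommGroup G] {l : Filter α}
    {f : α → EuclideanSpace ℝ ι} {g : α → G}
    (h : ∀ s, (fun a => f a s) =o[l] g) : f =o[l] g := by
  classical
  have h1 : f = fun a => ∑ s, (f a s) • (EuclideanSpace.single s (1 : ℝ) : EuclideanSpace ℝ ι) := by
    ext a
    conv_lhs => rw [← (EuclideanSpace.basisFun ι ℝ).sum_repr (f a)]
    simp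
  rw [h1]
  refine IsLittleO.fun_sum fun s _ => ?_
  have h2 : (fun a => ‖(f a s) • (EuclideanSpace.single s (1 : ℝ) : EuclideanSpace ℝ ι)‖) =o[l] g :=
    ((isLittleO_norm_left (f' := fun a => f a s)).2 (h s)).congr_left fun a => by simp [norm_smul]
  exact isLittleO_norm_left.1 h2

/-- Roots are, to first order, linear in the centred failure frequencies. -/
theorem root_expansion (γ : ℝ) {τ : Fin I → ℝ} (hτ : ∀ i, 0 < τ i)
    (x : Fin I → Fin (J + 1) → ℝ) {w : Fin I → ℝ} (hw : ∀ i, 0 ≤ w i)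
    {m : Param J → EuclideanSpace ℝ (Fin r)} {θ₀ : Param J} (hm₀ : m θ₀ = 0)
    (hm_diff : DifferentiableAt ℝ m θ₀)
    (hm_cont : ContinuousAt (restrMatrix m) θ₀) (hm_rank : (restrMatrix m θ₀).rank = r)
    (hJ : IsUnit (matJ γ τ x w θ₀).det) {α : Type*} {l : Filter α}
    {k y : α → Fin I → ℝ} {θ : α → Param J} (hk : Tendsto k l (𝓝 w)) (hθ : Tendsto θ l (𝓝 θ₀))
    (hroot : ∀ᶠ a in l,
      (∃ lam, score γ τ x (k a) (y a) (θ a) + restrMatrix m (θ a) *ᵥ lam = 0) ∧ m (θ a) = 0) :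
    (fun a => θ a - θ₀ - ∑ i, (y a i - k a i * failProb (τ i) (x i) θ₀) •
      leadingTerm γ τ x w m θ₀ i) =o[l]
      fun a => (fun i => y a i - k a i * failProb (τ i) (x i) θ₀) := by
  set 𝒥 := matJ γ τ x w θ₀ with h𝒥
  set M := restrMatrix m θ₀ with hM
  set z : α → Fin I → ℝ := fun a i => y a i - k a i * failProb (τ i) (x i) θ₀ with hz
  let d : α → Param J := fun a => θ a - θ₀
  have hpd : 𝒥.PosDef :=
    (matJ_posSemidef γ hτ x hw θ₀).posDef_iff_isUnit.2 ((Matrix.isUnit_iff_isUnit_det _).2 hJ)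
  have hunit : IsUnit (Mᵀ * 𝒥⁻¹ * M).det := isUnit_det_restr hpd hm_rank
  have hdet : ∀ᶠ a in l, IsUnit ((restrMatrix m (θ a))ᵀ * 𝒥⁻¹ * restrMatrix m (θ a)).det := by
    have h1 : Continuous fun N : Matrix (Coord J) (Fin r) ℝ => (Nᵀ * 𝒥⁻¹ * N).det := by fun_prop
    have h2 := (h1.continuousAt.comp hm_cont).tendsto.comp hθ
    filter_upwards [h2.eventually_ne hunit.ne_zero] with a ha
    exact ha.isUnit
  have hP : Tendsto (fun a => matP 𝒥 (restrMatrix m (θ a))) l (𝓝 (matP 𝒥 M)) :=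
    (continuousAt_matP hunit).tendsto.comp (hm_cont.tendsto.comp hθ)
  let c : α → Fin I → Coord J → ℝ := fun a i =>
    matP 𝒥 (restrMatrix m (θ a)) *ᵥ weightedGrad γ (τ i) (x i) (θ a)
  let c₀ : Fin I → Coord J → ℝ := fun i => matP 𝒥 M *ᵥ weightedGrad γ (τ i) (x i) θ₀
  have hc : ∀ i s, Tendsto (fun a => c a i s) l (𝓝 (c₀ i s)) := fun i s => by
    have h1 : Tendsto (fun a => weightedGrad γ (τ i) (x i) (θ a)) l
        (𝓝 (weightedGrad γ (τ i) (x i) θ₀)) :=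
      ((continuous_weightedGrad γ (hτ i) (x i)).tendsto θ₀).comp hθ
    have h2 : Continuous fun p : Matrix (Coord J) (Coord J) ℝ × (Coord J → ℝ) => p.1 *ᵥ p.2 := by
      fun_prop
    exact tendsto_pi_nhds.1 ((h2.tendsto (matP 𝒥 M, weightedGrad γ (τ i) (x i) θ₀)).comp
      (hP.prodMk_nhds h1)) s
  -- the projected estimating equations do not involve the multipliers
  have heq : ∀ᶠ a in l, ∀ s, ∑ i, k a i * c a i s *
      (failProb (τ i) (x i) (θ a) - failProb (τ i) (x i) θ₀) = ∑ i, z a i * c a i s := by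
    filter_upwards [hroot, hdet] with a ⟨⟨lam, hlam⟩, _⟩ ha s
    have h1 := congrArg (fun u => (matP 𝒥 (restrMatrix m (θ a)) *ᵥ u) s) hlam
    simp only [Matrix.mulVec_add, Matrix.mulVec_mulVec, matP_mul_restr ha, Matrix.zero_mulVec,
      add_zero, Matrix.mulVec_zero, score, Matrix.mulVec_sum, Matrix.mulVec_smul,
      Finset.sum_apply, Pi.smul_apply, Pi.zero_apply, smul_eq_mul] at h1
    rw [← sub_eq_zero, ← Finset.sum_sub_distrib, ← h1]
    refine Finset.sum_congr rfl fun i _ => ?_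
    simp only [c, hz]
    ring
  have hF : ∀ i, (fun a => failProb (τ i) (x i) (θ a) - failProb (τ i) (x i) θ₀ -
      gradFailProb (τ i) (x i) θ₀ ⬝ᵥ d a) =o[l] d := fun i => by
    have h1 := (((contDiff_failProb (hτ i) (x i)).differentiable (by simp)) θ₀).hasFDerivAt
    have h2 := h1.isLittleO.comp_tendsto hθ
    refine h2.congr_left fun a => ?_
    simp only [Function.comp, d, gradFailProb_dotProduct]
  have hG : ∀ i, (fun a => gradFailProb (τ i) (x i) θ₀ ⬝ᵥ d a) =O[l] d := fun i => by
    simp only [gradFailProb_dotProduct]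
    exact ContinuousLinearMap.isBigO_comp _ _ _
  -- `m` vanishes both at the root and at `θ₀`, so its linear part along the displacement is only a
  -- remainder term.
  have hMd : ∀ j, (fun a => (Mᵀ *ᵥ d a) j) =o[l] d := fun j => by
    have h1 := hm_diff.hasFDerivAt.isLittleO.comp_tendsto hθ
    have h2 : (fun a => fderiv ℝ m θ₀ (d a)) =o[l] d := by
      refine h1.neg_left.congr' ?_ EventuallyEq.rfl
      filter_upwards [hroot] with a ha
      simp [d, ha.2, hm₀]
    refine ((isBigO_apply_euclidean _ j).trans_isLittleO h2).congr_left fun a => ?_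
    rw [fderiv_restr_apply]
  have hcoord : ∀ s, (fun a => (d a - ∑ i, z a i • leadingTerm γ τ x w m θ₀ i) s -
      (∑ i, z a i * (c a i s - c₀ i s))) =o[l] d := fun s => by
    have hid : ∀ a, (d a : Coord J → ℝ) s = ∑ i, w i * c₀ i s *
        (gradFailProb (τ i) (x i) θ₀ ⬝ᵥ d a) + ∑ j, matQ 𝒥 M s j * (Mᵀ *ᵥ d a) j := fun a => by
      have h1 : (matP 𝒥 M * 𝒥 + matQ 𝒥 M * Mᵀ) *ᵥ (d a : Coord J → ℝ) = d a := by
        rw [matP_mul_add hJ, Matrix.one_mulVec]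
      have h2 := congrFun h1 s
      rw [Matrix.add_mulVec, ← Matrix.mulVec_mulVec, ← Matrix.mulVec_mulVec, h𝒥, matJ_eq γ hτ,
        Matrix.sum_mulVec, Matrix.mulVec_sum, ← matJ_eq γ hτ, ← h𝒥] at h2
      rw [← h2]
      simp only [Pi.add_apply, Finset.sum_apply, Matrix.smul_mulVec, Matrix.vecMulVec_mulVec,
        Matrix.mulVec_smul, Pi.smul_apply]
      congr 1
      refine Finset.sum_congr rfl fun i _ => ?_
      simp [c₀]
      ring
    have hlead : ∀ a, (∑ i, z a i • leadingTerm γ τ x w m θ₀ i) s = ∑ i, z a i * c₀ i s :=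
      fun a => by simp [leadingTerm, c₀, h𝒥, hM]
    have hterm : ∀ i, (fun a => k a i * c a i s *
        (failProb (τ i) (x i) (θ a) - failProb (τ i) (x i) θ₀) -
        w i * c₀ i s * (gradFailProb (τ i) (x i) θ₀ ⬝ᵥ d a)) =o[l] d := fun i => by
      have hkc : Tendsto (fun a => k a i * c a i s) l (𝓝 (w i * c₀ i s)) :=
        (tendsto_pi_nhds.1 hk i).mul (hc i s)
      have h2 : (fun a => (k a i * c a i s - w i * c₀ i s) *
          (gradFailProb (τ i) (x i) θ₀ ⬝ᵥ d a)) =o[l] fun a => (1 : ℝ) * ‖d a‖ :=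
        ((isLittleO_one_iff ℝ).2 (by simpa using hkc.sub_const (w i * c₀ i s))).mul_isBigO
          (hG i).norm_right
      have h1' := (hkc.isBigO_one ℝ).mul_isLittleO (hF i).norm_right
      have h3 := h1'.add h2
      simp only [one_mul] at h3
      refine (h3.congr_left fun a => ?_).of_norm_right
      ring
    have hsum := (IsLittleO.fun_sum (s := Finset.univ) fun i _ => hterm i).neg_left.add
      (IsLittleO.fun_sum (s := Finset.univ) fun j _ => (hMd j).const_mul_left (matQ 𝒥 M s j))
    refine hsum.congr' ?_ EventuallyEq.rfl
    filter_upwards [heq] with a ha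
    rw [PiLp.sub_apply, hlead, hid]
    rw [Finset.sum_sub_distrib, ha s]
    simp only [mul_sub, Finset.sum_sub_distrib]
    ring
  have hzc : ∀ s, (fun a => ∑ i, z a i * (c a i s - c₀ i s)) =o[l] z := fun s => by
    refine IsLittleO.fun_sum fun i _ => ?_
    have h1 : (fun a => z a i) =O[l] z :=
      IsBigO.of_bound 1 (Eventually.of_forall fun a => by simpa using norm_le_pi_norm (z a) i)
    have h2 : (fun a => c a i s - c₀ i s) =o[l] fun _ => (1 : ℝ) :=
      (isLittleO_one_iff ℝ).2 (by simpa using (hc i s).sub_const (c₀ i s))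
    have := h1.norm_right.mul_isLittleO h2
    simpa using this
  have hdz : ∀ s, (fun a => (d a - ∑ i, z a i • leadingTerm γ τ x w m θ₀ i) s) =o[l]
      fun a => ‖d a‖ + ‖z a‖ := fun s => by
    have h1 : d =O[l] fun a => ‖d a‖ + ‖z a‖ :=
      IsBigO.of_bound 1 (Eventually.of_forall fun a => by
        rw [Real.norm_of_nonneg (by positivity)]; linarith [norm_nonneg (z a)])
    have h2 : z =O[l] fun a => ‖d a‖ + ‖z a‖ :=
      IsBigO.of_bound 1 (Eventually.of_forall fun a => by
        rw [Real.norm_of_nonneg (by positivity)]; linarith [norm_nonneg (d a)])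
    refine (((hcoord s).trans_isBigO h1).add ((hzc s).trans_isBigO h2)).congr_left fun a => ?_
    ring
  have hmain := isLittleO_euclidean hdz
  have hlz : (fun a => ∑ i, z a i • leadingTerm γ τ x w m θ₀ i) =O[l] z := by
    refine IsBigO.fun_sum fun i _ => ?_
    refine IsBigO.of_bound ‖leadingTerm γ τ x w m θ₀ i‖ (Eventually.of_forall fun a => ?_)
    rw [norm_smul, mul_comm]
    exact mul_le_mul_of_nonneg_left (norm_le_pi_norm (z a) i) (norm_nonneg _)
  -- The error `‖d‖ + ‖z‖` is absorbed: with factor `1 / 2` it gives `‖d‖ ≤ 2 * ‖leading sum‖ +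
  -- ‖z‖`, whence the constant `2 * C + 1`.
  have hdO : d =O[l] z := by
    obtain ⟨C, hC0, hC⟩ := hlz.exists_nonneg
    refine IsBigO.of_bound (2 * C + 1) ?_
    filter_upwards [hmain.bound (show (0 : ℝ) < 1 / 2 by norm_num), hC.bound] with a h1 h2
    rw [Real.norm_of_nonneg (by positivity)] at h1
    have h3 := norm_sub_norm_le (d a) (∑ i, z a i • leadingTerm γ τ x w m θ₀ i)
    linarith [h3.trans h1]
  refine hmain.trans_isBigO ?_
  exact hdO.norm_left.add (isBigO_refl z l).norm_left

/-! ### The log-logistic distribution function -/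

lemma logLogisticMeasure_Iic {α β t : ℝ} (hα : 0 < α) (hβ : 0 < β) (ht : 0 < t) :
    logLogisticMeasure α β (Set.Iic t) = ENNReal.ofReal (logLogisticCDF α β t) := by
  have hαβ := Real.rpow_pos_of_pos hα β
  have hcont : ContinuousOn (logLogisticCDF α β) (Set.Icc 0 t) := by
    unfold logLogisticCDF
    have h : Continuous fun u : ℝ => u ^ β := Real.continuous_rpow_const hβ.le
    refine h.continuousOn.div (h.add continuous_const).continuousOn fun u hu => ?_
    have := Real.rpow_nonneg hu.1 β
    positivity
  have hderiv : ∀ u ∈ Set.Ioo 0 t, HasDerivAt (logLogisticCDF α β) (logLogisticPDF α β u) u := by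
    intro u hu
    have hu0 := Real.rpow_pos_of_pos hu.1 β
    have h1 : HasDerivAt (fun u : ℝ => u ^ β) (β * u ^ (β - 1)) u :=
      Real.hasDerivAt_rpow_const (Or.inl hu.1.ne')
    have h2 := h1.div (h1.add_const (α ^ β)) (by positivity)
    convert! h2 using 1
    rw [logLogisticPDF, if_pos hu.1]
    ring
  have hnonneg : ∀ u, 0 ≤ logLogisticPDF α β u := by
    intro u
    unfold logLogisticPDF
    split_ifs with h
    · positivity
    · exact le_rfl
  -- A nonnegative derivative of a function continuous up to the endpoints is integrable; this
  -- covers the singularity of the density at `0` when `β < 1`.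
  have hint : IntegrableOn (logLogisticPDF α β) (Set.Ioc 0 t) :=
    intervalIntegral.integrableOn_deriv_of_nonneg hcont hderiv fun u _ => hnonneg u
  have hFTC := intervalIntegral.integral_eq_sub_of_hasDerivAt_of_le ht.le hcont hderiv
    ((intervalIntegrable_iff_integrableOn_Ioc_of_le ht.le).2 hint)
  have h0 : logLogisticCDF α β 0 = 0 := by simp [logLogisticCDF, Real.zero_rpow hβ.ne']
  rw [h0, sub_zero, intervalIntegral.integral_of_le ht.le] at hFTC
  rw [logLogisticMeasure, withDensity_apply _ measurableSet_Iic, ← hFTC,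
    ofReal_integral_eq_lintegral_ofReal hint (Eventually.of_forall hnonneg)]
  rw [← lintegral_indicator measurableSet_Iic, ← lintegral_indicator measurableSet_Ioc]
  congr 1
  funext u
  by_cases h : 0 < u <;> simp [Set.indicator_apply, logLogisticPDF, h]

/-! ### Centred failure indicators -/

/-- The indicator of a lifetime up to time `t`, centred at the failure probability `q`. -/
def centredIndicator (q t u : ℝ) : ℝ := (if u ≤ t then 1 else 0) - q

lemma measurable_centredIndicator (q t : ℝ) : Measurable (centredIndicator q t) :=
  (Measurable.ite measurableSet_Iic measurable_const measurable_const).sub_const q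

lemma failures_sub_eq_sum {κ : ℕ} {Ω : Type*} (T : Fin κ → Ω → ℝ) (q t : ℝ) (ω : Ω) :
    (failures T t ω : ℝ) - κ * q = ∑ k, centredIndicator q t (T k ω) := by
  classical
  simp [failures, centredIndicator, Finset.sum_sub_distrib]

/-- The characteristic function of a centred Bernoulli variable with parameter `q`. -/
def bernoulliCharFun (q s : ℝ) : ℂ :=
  q * Complex.exp (s * (1 - q) * Complex.I) + (1 - q) * Complex.exp (s * (-q) * Complex.I)

section Law

variable {Ω : Type*} [MeasurableSpace Ω] {P : Measure Ω} [IsProbabilityMeasure P]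

/-- The variable takes only two values, so `f` composed with it is a combination of two indicators
and `f` itself may be arbitrary. -/
lemma integral_comp_centredIndicator {G : Type*} [NormedAddCommGroup G] [NormedSpace ℝ G]
    [CompleteSpace G] {X : Ω → ℝ} {μ : Measure ℝ} (hX : HasLaw X μ P) {q t : ℝ} (hq : 0 ≤ q)
    (hμ : μ (Set.Iic t) = ENNReal.ofReal q) (f : ℝ → G) :
    ∫ ω, f (centredIndicator q t (X ω)) ∂P = q • f (1 - q) + (1 - q) • f (-q) := by
  have hprob : IsProbabilityMeasure μ := by
    rw [← hX.map_eq]; exact Measure.isProbabilityMeasure_map hX.aemeasurable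
  have hf : (fun u => f (centredIndicator q t u)) = fun u =>
      (Set.Iic t).indicator (fun _ => f (1 - q)) u + (Set.Iic t)ᶜ.indicator (fun _ => f (-q)) u := by
    funext u
    by_cases hu : u ≤ t
    · simp [centredIndicator, hu]
    · have hu' : t < u := not_le.1 hu
      simp [centredIndicator, hu, hu']
  have hi1 : Integrable ((Set.Iic t).indicator fun _ => f (1 - q)) μ :=
    (integrable_const _).indicator measurableSet_Iic
  have hi2 : Integrable ((Set.Iic t)ᶜ.indicator fun _ => f (-q)) μ :=
    (integrable_const _).indicator measurableSet_Iic.compl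
  have hmeas : AEStronglyMeasurable (fun u => f (centredIndicator q t u)) μ := by
    rw [hf]; exact (hi1.add hi2).aestronglyMeasurable
  have h1 := hX.integral_comp hmeas
  have hr : μ.real (Set.Iic t) = q := by rw [measureReal_def, hμ, ENNReal.toReal_ofReal hq]
  rw [Function.comp_def] at h1
  rw [h1, hf, integral_add hi1 hi2, integral_indicator_const _ measurableSet_Iic,
    integral_indicator_const _ measurableSet_Iic.compl, probReal_compl_eq_one_sub measurableSet_Iic,
    hr]

lemma charFun_map_smul_centredIndicator {X : Ω → ℝ} {μ : Measure ℝ} (hX : HasLaw X μ P)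
    {q t : ℝ} (hq : 0 ≤ q) (hμ : μ (Set.Iic t) = ENNReal.ofReal q) (c : ℝ) (b u : Param J) :
    charFun (P.map fun ω => (c * centredIndicator q t (X ω)) • b) u =
      bernoulliCharFun q (c * inner ℝ b u) := by
  have hm : AEMeasurable (fun ω => (c * centredIndicator q t (X ω)) • b) P :=
    (((measurable_centredIndicator q t).comp_aemeasurable hX.aemeasurable).const_mul c).smul_const b
  rw [charFun_apply, integral_map hm (by fun_prop)]
  rw [integral_comp_centredIndicator hX hq hμ
    (fun v => Complex.exp ((inner ℝ ((c * v) • b) u : ℝ) * Complex.I)), bernoulliCharFun]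
  simp only [inner_smul_left, Complex.real_smul]
  push_cast
  simp only [conj_trivial]
  push_cast
  ring_nf

variable {κ : Fin I → ℕ} {T : (i : Fin I) → Fin (κ i) → Ω → ℝ} {μ : Fin I → Measure ℝ}
  {q τ : Fin I → ℝ}

omit [IsProbabilityMeasure P] in
lemma aemeasurable_failures (hT : ∀ i k, HasLaw (T i k) (μ i) P) (i : Fin I) :
    AEMeasurable (fun ω => (failures (T i) (τ i) ω : ℝ) - κ i * q i) P := by
  simp only [failures_sub_eq_sum]
  exact Finset.aemeasurable_fun_sum _ fun k _ =>
    (measurable_centredIndicator _ _).comp_aemeasurable (hT i k).aemeasurable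

/-- The characteristic function of a linear combination of the centred numbers of failures. -/
lemma charFun_sum_failures (hT : ∀ i k, HasLaw (T i k) (μ i) P) (hq : ∀ i, 0 ≤ q i)
    (hμ : ∀ i, μ i (Set.Iic (τ i)) = ENNReal.ofReal (q i))
    (hind : iIndepFun (fun p : (i : Fin I) × Fin (κ i) => T p.1 p.2) P)
    (c : ℝ) (b : Fin I → Param J) (u : Param J) :
    charFun (P.map fun ω => ∑ i, (c * ((failures (T i) (τ i) ω : ℝ) - κ i * q i)) • b i) u =
      ∏ i, bernoulliCharFun (q i) (c * inner ℝ (b i) u) ^ κ i := by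
  have h1 : (fun ω => ∑ i, (c * ((failures (T i) (τ i) ω : ℝ) - κ i * q i)) • b i) =
      fun ω => ∑ p : (i : Fin I) × Fin (κ i),
        (c * centredIndicator (q p.1) (τ p.1) (T p.1 p.2 ω)) • b p.1 := by
    funext ω
    rw [Fintype.sum_sigma]
    refine Finset.sum_congr rfl fun i _ => ?_
    rw [failures_sub_eq_sum, Finset.mul_sum, Finset.sum_smul]
  have hg : ∀ p : (i : Fin I) × Fin (κ i), Measurable fun v : ℝ =>
      (c * centredIndicator (q p.1) (τ p.1) v) • b p.1 := fun p =>
    ((measurable_centredIndicator _ _).const_mul c).smul_const _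
  have hind' := hind.comp (fun p v => (c * centredIndicator (q p.1) (τ p.1) v) • b p.1) hg
  have h2 := iIndepFun.charFun_map_fun_sum_eq_prod
    (fun p => (hg p).comp_aemeasurable (hT p.1 p.2).aemeasurable) hind'
  simp only [Function.comp_def] at h2
  rw [h1, h2, Finset.prod_apply, Fintype.prod_sigma]
  refine Finset.prod_congr rfl fun i _ => ?_
  simp only [charFun_map_smul_centredIndicator (hT i _) (hq i) (hμ i)]
  simp

/-- Chebyshev's inequality for the number of failures. -/
lemma measure_failures_ge_le (hT : ∀ i k, HasLaw (T i k) (μ i) P)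
    (hq : ∀ i, 0 ≤ q i) (hq1 : ∀ i, q i ≤ 1)
    (hμ : ∀ i, μ i (Set.Iic (τ i)) = ENNReal.ofReal (q i))
    (hind : iIndepFun (fun p : (i : Fin I) × Fin (κ i) => T p.1 p.2) P) (i : Fin I)
    {c : ℝ} (hc : 0 < c) :
    P {ω | c ≤ |(failures (T i) (τ i) ω : ℝ) - κ i * q i|} ≤ ENNReal.ofReal (κ i / c ^ 2) := by
  have hY : ∀ k, AEMeasurable (fun ω => centredIndicator (q i) (τ i) (T i k ω)) P := fun k =>
    (measurable_centredIndicator _ _).comp_aemeasurable (hT i k).aemeasurable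
  have hbd : ∀ k ω, centredIndicator (q i) (τ i) (T i k ω) ∈ Set.Icc (-1 : ℝ) 1 := fun k ω => by
    have := hq i
    have := hq1 i
    unfold centredIndicator
    split_ifs <;> constructor <;> linarith
  have hL : ∀ k, MemLp (fun ω => centredIndicator (q i) (τ i) (T i k ω)) 2 P := fun k =>
    memLp_of_bounded (Eventually.of_forall (hbd k)) (hY k).aestronglyMeasurable 2
  have hind' : Set.Pairwise (Finset.univ : Finset (Fin (κ i))) fun k l =>
      IndepFun (fun ω => centredIndicator (q i) (τ i) (T i k ω))
        (fun ω => centredIndicator (q i) (τ i) (T i l ω)) P := fun k _ l _ hkl => by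
    have h1 : IndepFun (T i k) (T i l) P :=
      hind.indepFun (i := ⟨i, k⟩) (j := ⟨i, l⟩) (by simpa using hkl)
    exact h1.comp (measurable_centredIndicator _ _) (measurable_centredIndicator _ _)
  have hvar := IndepFun.variance_sum (fun k _ => hL k) hind'
  have hvarle : ∑ k, Var[fun ω => centredIndicator (q i) (τ i) (T i k ω); P] ≤ κ i := by
    -- Values in `[-1, 1]` have variance at most `1`; this crude bound suffices for tightness.
    calc _ ≤ ∑ _k : Fin (κ i), (1 : ℝ) := Finset.sum_le_sum fun k _ => by
          have := variance_le_sq_of_bounded (Eventually.of_forall (hbd k)) (hY k)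
          norm_num at this
          exact this
      _ = κ i := by simp
  have hmean : ∫ ω, (∑ k, fun ω => centredIndicator (q i) (τ i) (T i k ω)) ω ∂P = 0 := by
    simp only [Finset.sum_apply]
    rw [integral_finsetSum _ fun k _ => (hL k).integrable (by norm_num)]
    refine Finset.sum_eq_zero fun k _ => ?_
    rw [integral_comp_centredIndicator (hT i k) (hq i) (hμ i) (fun v => v)]
    simp only [smul_eq_mul]
    ring
  have hcheb := meas_ge_le_variance_div_sq
    (memLp_finsetSum' Finset.univ fun k _ => hL k) hc
  rw [hmean, hvar] at hcheb
  have hset : {ω | c ≤ |(failures (T i) (τ i) ω : ℝ) - κ i * q i|} =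
      {ω | c ≤ |(∑ k, fun ω => centredIndicator (q i) (τ i) (T i k ω)) ω - 0|} := by
    ext ω
    simp [failures_sub_eq_sum]
  rw [hset]
  refine hcheb.trans (ENNReal.ofReal_le_ofReal ?_)
  gcongr

end Law

/-! ### Limits of characteristic functions -/

/-- Second-order Taylor expansion at the two values: centring cancels the linear term, and the
quadratic terms add up to the variance `q * (1 - q)`. -/
lemma norm_bernoulliCharFun_sub_le {q s : ℝ} (hq : 0 ≤ q) (hq1 : q ≤ 1) (hs : |s| ≤ 1) :
    ‖bernoulliCharFun q s - 1 + (q * (1 - q) * s ^ 2 / 2 : ℝ)‖ ≤ |s| ^ 3 := by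
  have key : ∀ v : ℝ, |v| ≤ 1 → ‖Complex.exp (s * v * Complex.I) -
      (1 + s * v * Complex.I - s ^ 2 * v ^ 2 / 2)‖ ≤ |s| ^ 3 := by
    intro v hv
    have hn : ‖(s * v * Complex.I : ℂ)‖ = |s| * |v| := by simp
    have hle : |s| * |v| ≤ |s| := mul_le_of_le_one_right (abs_nonneg _) hv
    have h := Complex.exp_bound (x := (s * v * Complex.I : ℂ)) (by rw [hn]; linarith)
      (n := 3) (by norm_num)
    have hsum : ∑ m ∈ Finset.range 3, (s * v * Complex.I : ℂ) ^ m / (m.factorial : ℂ) =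
        1 + s * v * Complex.I - s ^ 2 * v ^ 2 / 2 := by
      simp [Finset.sum_range_succ, Nat.factorial, mul_pow]
      ring
    rw [hsum, hn] at h
    refine h.trans ?_
    have h3 : (|s| * |v|) ^ 3 ≤ |s| ^ 3 := pow_le_pow_left₀ (by positivity) hle 3
    norm_num [Nat.factorial]
    nlinarith [pow_nonneg (mul_nonneg (abs_nonneg s) (abs_nonneg v)) 3]
  have h1 := key (1 - q) (by rw [abs_of_nonneg] <;> linarith)
  have h2 := key (-q) (by rw [abs_neg, abs_of_nonneg] <;> linarith)
  have hid : bernoulliCharFun q s - 1 + (q * (1 - q) * s ^ 2 / 2 : ℝ) =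
      (q : ℂ) * (Complex.exp (s * (1 - q : ℝ) * Complex.I) -
        (1 + s * (1 - q : ℝ) * Complex.I - s ^ 2 * (1 - q : ℝ) ^ 2 / 2)) +
      ((1 - q : ℝ) : ℂ) * (Complex.exp (s * (-q : ℝ) * Complex.I) -
        (1 + s * (-q : ℝ) * Complex.I - s ^ 2 * (-q : ℝ) ^ 2 / 2)) := by
    rw [bernoulliCharFun]
    push_cast
    ring
  rw [hid]
  refine (norm_add_le _ _).trans ?_
  rw [norm_mul, norm_mul, Complex.norm_real, Complex.norm_real, Real.norm_of_nonneg hq,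
    Real.norm_of_nonneg (sub_nonneg.2 hq1)]
  nlinarith [mul_le_mul_of_nonneg_left h1 hq, mul_le_mul_of_nonneg_left h2 (sub_nonneg.2 hq1)]

/-- The error in `κ * log (1 + g) ≈ κ * g` is of order `|κ * g| * |g|`, which tends to zero. The
exponents need not tend to infinity, so conditions with few devices are covered. -/
lemma tendsto_one_add_pow_exp {α : Type*} {l : Filter α} {g : α → ℂ} {κ : α → ℕ} {z : ℂ}
    (hg : Tendsto g l (𝓝 0)) (hκ : Tendsto (fun a => κ a * g a) l (𝓝 z)) :
    Tendsto (fun a => (1 + g a) ^ κ a) l (𝓝 (Complex.exp z)) := by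
  have hlog : Tendsto (fun a => κ a * Complex.log (1 + g a)) l (𝓝 z) := by
    have h0 : Tendsto (fun a => κ a * (Complex.log (1 + g a) - g a)) l (𝓝 0) := by
      have hb : Tendsto (fun a => ‖κ a * g a‖ * ‖g a‖) l (𝓝 0) := by
        simpa using hκ.norm.mul hg.norm
      refine squeeze_zero_norm' ?_ hb
      have hsmall : ∀ᶠ a in l, ‖g a‖ < 1 / 2 := by
        have := hg.norm
        rw [norm_zero] at this
        exact this.eventually_lt_const (by norm_num)
      filter_upwards [hsmall] with a ha
      have h1 := Complex.norm_log_one_add_sub_self_le (z := g a) (by linarith)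
      rw [norm_mul, norm_mul, mul_assoc]
      refine mul_le_mul_of_nonneg_left (h1.trans ?_) (norm_nonneg _)
      have h2 : (1 - ‖g a‖)⁻¹ ≤ 2 := by
        rw [inv_le_comm₀ (by linarith) (by norm_num)]
        linarith
      nlinarith [sq_nonneg ‖g a‖]
    have := h0.add hκ
    rw [zero_add] at this
    refine this.congr fun a => ?_
    ring
  have hexp := (Complex.continuous_exp.tendsto z).comp hlog
  refine hexp.congr' ?_
  have hne : ∀ᶠ a in l, 1 + g a ≠ 0 := by
    have : Tendsto (fun a => 1 + g a) l (𝓝 1) := by simpa using hg.const_add 1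
    exact this.eventually_ne one_ne_zero
  filter_upwards [hne] with a ha
  rw [Function.comp_apply, Complex.exp_nat_mul, Complex.exp_log ha]

/-- Normalising by the total `N` rather than by `κ` allows the limiting proportion `v` to be zero.
-/
lemma tendsto_bernoulliCharFun_pow {q v a : ℝ} (hq : 0 ≤ q) (hq1 : q ≤ 1) {κ N : ℕ → ℕ}
    (hN : Tendsto N atTop atTop) (hκ : Tendsto (fun n => (κ n : ℝ) / N n) atTop (𝓝 v)) :
    Tendsto (fun n => bernoulliCharFun q ((√(N n))⁻¹ * a) ^ κ n) atTop
      (𝓝 (Complex.exp ((-(v * (q * (1 - q)) * a ^ 2 / 2) : ℝ) : ℂ))) := by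
  set s : ℕ → ℝ := fun n => (√(N n))⁻¹ * a with hs
  have hNpos : ∀ᶠ n in atTop, (0 : ℝ) < N n := by
    filter_upwards [hN.eventually_gt_atTop 0] with n hn
    exact_mod_cast hn
  have hs0 : Tendsto s atTop (𝓝 0) := by
    rw [← zero_mul a]
    exact (tendsto_inv_atTop_zero.comp (Real.tendsto_sqrt_atTop.comp
      (tendsto_natCast_atTop_atTop.comp hN))).mul_const a
  have hNs : ∀ᶠ n in atTop, (N n : ℝ) * s n ^ 2 = a ^ 2 := by
    filter_upwards [hNpos] with n hn
    simp only [hs, mul_pow, inv_pow, Real.sq_sqrt hn.le]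
    field_simp
  have hsmall : ∀ᶠ n in atTop, |s n| ≤ 1 := by
    have := hs0.abs
    rw [abs_zero] at this
    exact (this.eventually_lt_const zero_lt_one).mono fun n h => h.le
  have hmain : Tendsto (fun n => (N n : ℂ) * (bernoulliCharFun q (s n) - 1)) atTop
      (𝓝 ((-(q * (1 - q) * a ^ 2 / 2) : ℝ) : ℂ)) := by
    have hrem : Tendsto (fun n => (N n : ℂ) * (bernoulliCharFun q (s n) - 1 +
        (q * (1 - q) * s n ^ 2 / 2 : ℝ))) atTop (𝓝 0) := by
      have hb : Tendsto (fun n => a ^ 2 * |s n|) atTop (𝓝 0) := by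
        simpa using hs0.abs.const_mul (a ^ 2)
      refine squeeze_zero_norm' ?_ hb
      filter_upwards [hNs, hsmall] with n h1 h2
      rw [norm_mul, Complex.norm_natCast, ← h1]
      calc (N n : ℝ) * _ ≤ N n * |s n| ^ 3 :=
            mul_le_mul_of_nonneg_left (norm_bernoulliCharFun_sub_le hq hq1 h2) (by positivity)
        _ = N n * s n ^ 2 * |s n| := by rw [← sq_abs (s n)]; ring
    have h := hrem.add_const (((-(q * (1 - q) * a ^ 2 / 2) : ℝ) : ℂ))
    rw [zero_add] at h
    refine h.congr' ?_
    filter_upwards [hNs] with n h1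
    rw [← h1]
    push_cast
    ring
  have hg : Tendsto (fun n => bernoulliCharFun q (s n) - 1) atTop (𝓝 0) := by
    have hinv : Tendsto (fun n => ((N n : ℂ))⁻¹) atTop (𝓝 0) :=
      (tendsto_inv_atTop_nhds_zero_nat (𝕜 := ℂ)).comp hN
    have h := hinv.mul hmain
    rw [zero_mul] at h
    refine h.congr' ?_
    filter_upwards [hNpos] with n hn
    have : (N n : ℂ) ≠ 0 := by exact_mod_cast hn.ne'
    field_simp
  have hκg : Tendsto (fun n => (κ n : ℂ) * (bernoulliCharFun q (s n) - 1)) atTop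
      (𝓝 ((-(v * (q * (1 - q)) * a ^ 2 / 2) : ℝ) : ℂ)) := by
    have h := ((Complex.continuous_ofReal.tendsto v).comp hκ).mul hmain
    have hval : (v : ℂ) * ((-(q * (1 - q) * a ^ 2 / 2) : ℝ) : ℂ) =
        ((-(v * (q * (1 - q)) * a ^ 2 / 2) : ℝ) : ℂ) := by push_cast; ring
    rw [hval] at h
    refine h.congr' ?_
    filter_upwards [hNpos] with n hn
    have : (N n : ℂ) ≠ 0 := by exact_mod_cast hn.ne'
    simp only [Function.comp_apply]
    push_cast
    field_simp
  refine (tendsto_one_add_pow_exp hg hκg).congr fun n => ?_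
  rw [add_sub_cancel]

/-! ### Asymptotic normality -/

/-- Uniform form of `root_expansion`. -/
lemma eventually_root_bound (γ : ℝ) {τ : Fin I → ℝ} (hτ : ∀ i, 0 < τ i)
    (x : Fin I → Fin (J + 1) → ℝ) {w : Fin I → ℝ} (hw : ∀ i, 0 ≤ w i)
    {m : Param J → EuclideanSpace ℝ (Fin r)} {θ₀ : Param J} (hm₀ : m θ₀ = 0)
    (hm_diff : DifferentiableAt ℝ m θ₀)
    (hm_cont : ContinuousAt (restrMatrix m) θ₀) (hm_rank : (restrMatrix m θ₀).rank = r)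
    (hJ : IsUnit (matJ γ τ x w θ₀).det) {c : ℝ} (hc : 0 < c) :
    ∀ᶠ p : (Fin I → ℝ) × Param J in 𝓝 (w, θ₀), ∀ y : Fin I → ℝ,
      (∃ lam, score γ τ x p.1 y p.2 + restrMatrix m p.2 *ᵥ lam = 0) ∧ m p.2 = 0 →
      ‖p.2 - θ₀ - ∑ i, (y i - p.1 i * failProb (τ i) (x i) θ₀) • leadingTerm γ τ x w m θ₀ i‖ ≤
        c * ‖fun i => y i - p.1 i * failProb (τ i) (x i) θ₀‖ := by
  let root : Set (((Fin I → ℝ) × Param J) × (Fin I → ℝ)) :=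
    {a | (∃ lam, score γ τ x a.1.1 a.2 a.1.2 + restrMatrix m a.1.2 *ᵥ lam = 0) ∧ m a.1.2 = 0}
  -- The filter consists of all triples forming a root, with `(k, θ)` near `(w, θ₀)` and `y`
  -- unconstrained; a little-o along it is a bound uniform in `y`.
  have hfst : Tendsto Prod.fst (comap Prod.fst (𝓝 (w, θ₀)) ⊓ 𝓟 root) (𝓝 (w, θ₀)) :=
    tendsto_comap.mono_left inf_le_left
  have h := root_expansion γ hτ x hw hm₀ hm_diff hm_cont hm_rank hJ
    (l := comap Prod.fst (𝓝 (w, θ₀)) ⊓ 𝓟 root) (k := fun a => a.1.1) (y := fun a => a.2)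
    (θ := fun a => a.1.2) ((continuous_fst.tendsto _).comp hfst)
    ((continuous_snd.tendsto _).comp hfst) (mem_inf_of_right (mem_principal_self root))
  have h1 := eventually_comap.1 (eventually_inf_principal.1 (h.bound hc))
  filter_upwards [h1] with p hp y hy
  exact hp (p, y) rfl hy

section Law

variable {Ω : Type*} [MeasurableSpace Ω] {P : Measure Ω} [IsProbabilityMeasure P]
  {μ : Fin I → Measure ℝ} {q τ : Fin I → ℝ}

lemma measure_exists_failures_ge_le {κ : Fin I → ℕ} {T : (i : Fin I) → Fin (κ i) → Ω → ℝ}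
    (hT : ∀ i k, HasLaw (T i k) (μ i) P) (hq : ∀ i, 0 ≤ q i) (hq1 : ∀ i, q i ≤ 1)
    (hμ : ∀ i, μ i (Set.Iic (τ i)) = ENNReal.ofReal (q i))
    (hind : iIndepFun (fun p : (i : Fin I) × Fin (κ i) => T p.1 p.2) P) {c : ℝ} (hc : 0 < c) :
    P {ω | ∃ i, c ≤ |(failures (T i) (τ i) ω : ℝ) - κ i * q i|} ≤
      I * ENNReal.ofReal ((∑ i, κ i : ℕ) / c ^ 2) := by
  rw [Set.ofPred_exists]
  refine (measure_iUnion_fintype_le P _).trans ?_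
  calc _ ≤ ∑ _i : Fin I, ENNReal.ofReal ((∑ i, κ i : ℕ) / c ^ 2) :=
        Finset.sum_le_sum fun i _ => by
          refine (measure_failures_ge_le hT hq hq1 hμ hind i hc).trans ?_
          refine ENNReal.ofReal_le_ofReal ?_
          gcongr
          exact Finset.single_le_sum (f := κ) (fun _ _ => Nat.zero_le _) (Finset.mem_univ i)
    _ = _ := by simp

variable {K : ℕ → Fin I → ℕ} {T : (n : ℕ) → (i : Fin I) → Fin (K n i) → Ω → ℝ}
  {w : Fin I → ℝ}

/-- Central limit theorem for linear combinations of the numbers of failures. -/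
theorem tendstoInDistribution_sum_failures (hK : Tendsto (fun n => ∑ i, K n i) atTop atTop)
    (hw : ∀ i, Tendsto (fun n => (K n i : ℝ) / ((∑ i', K n i' : ℕ) : ℝ)) atTop (𝓝 (w i)))
    (hT : ∀ n i k, HasLaw (T n i k) (μ i) P) (hq : ∀ i, 0 ≤ q i) (hq1 : ∀ i, q i ≤ 1)
    (hμ : ∀ i, μ i (Set.Iic (τ i)) = ENNReal.ofReal (q i))
    (hind : ∀ n, iIndepFun (fun p : (i : Fin I) × Fin (K n i) => T n p.1 p.2) P)
    (b : Fin I → Param J) {S : Matrix (Coord J) (Coord J) ℝ} (hS : S.PosSemidef)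
    (hSb : ∀ u : Param J, u ⬝ᵥ S *ᵥ u = ∑ i, w i * (q i * (1 - q i)) * inner ℝ (b i) u ^ 2) :
    TendstoInDistribution (fun n ω => ∑ i, ((√((∑ i, K n i : ℕ) : ℝ))⁻¹ *
      ((failures (T n i) (τ i) ω : ℝ) - K n i * q i)) • b i) atTop
      (id : Param J → Param J) (fun _ => P) (multivariateGaussian 0 S) where
  forall_aemeasurable n := Finset.aemeasurable_fun_sum _ fun i _ =>
    ((aemeasurable_failures (hT n) i).const_mul _).smul_const _
  tendsto := by
    refine ProbabilityMeasure.tendsto_iff_tendsto_charFun.2 fun u => ?_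
    -- By the quadratic form identity `hSb`, the Gaussian characteristic function factors over the
    -- testing conditions, matching the product for the counts.
    have hlim : charFun ((multivariateGaussian 0 S).map (id : Param J → Param J)) u =
        ∏ i, Complex.exp ((-(w i * (q i * (1 - q i)) * inner ℝ (b i) u ^ 2 / 2) : ℝ) : ℂ) := by
      rw [Measure.map_id, charFun_multivariateGaussian hS, ← Complex.exp_sum]
      congr 1
      rw [inner_zero_right, Complex.ofReal_zero, zero_mul, zero_sub, ← Complex.ofReal_sum,
        Finset.sum_neg_distrib, ← Finset.sum_div, ← hSb]
      push_cast
      rfl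
    refine (tendsto_finsetProd Finset.univ fun i _ => tendsto_bernoulliCharFun_pow
      (a := inner ℝ (b i) u) (hq i) (hq1 i) hK (hw i)).congr' ?_ |>.trans (by
        rw [← hlim]; exact le_rfl)
    refine Eventually.of_forall fun n => ?_
    exact (charFun_sum_failures (hT n) hq hμ (hind n) _ b u).symm

end Law

/-- The covariance of the leading term of a root. -/
lemma dotProduct_asympCov_mulVec (γ : ℝ) {τ : Fin I → ℝ} (hτ : ∀ i, 0 < τ i)
    (x : Fin I → Fin (J + 1) → ℝ) {w : Fin I → ℝ} (hw : ∀ i, 0 ≤ w i)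
    (m : Param J → EuclideanSpace ℝ (Fin r)) (θ u : Param J) :
    u ⬝ᵥ asympCov γ τ x w m θ *ᵥ u = ∑ i, w i *
      (failProb (τ i) (x i) θ * (1 - failProb (τ i) (x i) θ)) *
        inner ℝ (leadingTerm γ τ x w m θ i) u ^ 2 := by
  have hsymm : (matJ γ τ x w θ).IsSymm := by
    have := (matJ_posSemidef γ hτ x hw θ).isHermitian
    rwa [Matrix.IsHermitian, Matrix.conjTranspose_eq_transpose_of_trivial] at this
  set A := matP (matJ γ τ x w θ) (restrMatrix m θ) with hA
  have hAT : Aᵀ = A := transpose_matP hsymm _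
  have h1 : ∀ i, inner ℝ (leadingTerm γ τ x w m θ i) u =
      weightedGrad γ (τ i) (x i) θ ⬝ᵥ A *ᵥ u := fun i => by
    rw [EuclideanSpace.inner_eq_star_dotProduct, leadingTerm, star_trivial, ← hA,
      Matrix.dotProduct_mulVec, ← Matrix.mulVec_transpose, hAT, dotProduct_comm]
  simp only [h1]
  have h2 : u ⬝ᵥ asympCov γ τ x w m θ *ᵥ u = (A *ᵥ u) ⬝ᵥ matK γ τ x w θ *ᵥ (A *ᵥ u) := by
    rw [asympCov, ← hA, ← Matrix.mulVec_mulVec, ← Matrix.mulVec_mulVec, Matrix.dotProduct_mulVec,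
      ← Matrix.mulVec_transpose, hAT]
  rw [h2, matK_eq γ hτ, Matrix.sum_mulVec, dotProduct_sum]
  refine Finset.sum_congr rfl fun i _ => ?_
  rw [Matrix.smul_mulVec, Matrix.vecMulVec_mulVec, dotProduct_smul, dotProduct_comm (A *ᵥ u)]
  simp
  exact Or.inl (by ring)

lemma asympCov_posSemidef (γ : ℝ) {τ : Fin I → ℝ} (hτ : ∀ i, 0 < τ i)
    (x : Fin I → Fin (J + 1) → ℝ) {w : Fin I → ℝ} (hw : ∀ i, 0 ≤ w i)
    (m : Param J → EuclideanSpace ℝ (Fin r)) (θ : Param J) :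
    (asympCov γ τ x w m θ).PosSemidef := by
  have hsymm : (matJ γ τ x w θ).IsSymm := by
    have := (matJ_posSemidef γ hτ x hw θ).isHermitian
    rwa [Matrix.IsHermitian, Matrix.conjTranspose_eq_transpose_of_trivial] at this
  have h := (matK_posSemidef γ hτ x hw θ).mul_mul_conjTranspose_same
    (matP (matJ γ τ x w θ) (restrMatrix m θ))
  rwa [Matrix.conjTranspose_eq_transpose_of_trivial, transpose_matP hsymm] at h

/-! ### Normalisation and selection of roots. -/

/-- Roots only depend on the relative frequencies. -/
lemma isRestrictedRoot_iff (γ : ℝ) {τ : Fin I → ℝ} (hτ : ∀ i, 0 < τ i)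
    (x : Fin I → Fin (J + 1) → ℝ) (m : Param J → EuclideanSpace ℝ (Fin r)) (K n : Fin I → ℕ)
    {N : ℝ} (hN : 0 < N) (θ : Param J) :
    IsRestrictedRoot γ τ x m K n θ ↔
      (∃ lam, score γ τ x (fun i => K i / N) (fun i => n i / N) θ + restrMatrix m θ *ᵥ lam = 0) ∧
        m θ = 0 := by
  have hs : score γ τ x (fun i => K i / N) (fun i => n i / N) θ =
      N⁻¹ • estFun γ τ x K n θ := by
    rw [estFun_eq_score γ hτ, ← score_smul]
    congr 1 <;> (ext i; simp [div_eq_inv_mul])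
  rw [IsRestrictedRoot, hs]
  refine and_congr_left fun _ => ⟨fun ⟨lam, h⟩ => ⟨N⁻¹ • lam, ?_⟩, fun ⟨lam, h⟩ => ⟨N • lam, ?_⟩⟩
  · rw [Matrix.mulVec_smul, ← smul_add, h, smul_zero]
  · have := congrArg (fun v => N • v) h
    simpa [smul_add, smul_smul, hN.ne', Matrix.mulVec_smul] using this

/-- The distance to the set of roots need not be attained, so a root is selected up to a slack. -/
lemma exists_almost_nearest {E : Type*} [PseudoMetricSpace E] {S : Set E} (hS : S.Nonempty)
    (a : E) {ε : ℝ} (hε : 0 < ε) : ∃ θ ∈ S, ∀ θ' ∈ S, dist θ a ≤ dist θ' a + ε := by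
  obtain ⟨θ, hθ, h⟩ := (Metric.infDist_lt_iff (r := Metric.infDist a S + ε) hS).1
    (lt_add_of_pos_right _ hε)
  refine ⟨θ, hθ, fun θ' hθ' => ?_⟩
  have := Metric.infDist_le_dist_of_mem (x := a) hθ'
  rw [dist_comm θ, dist_comm θ']
  linarith

end

end OneShot

/-! ### Existence of consistent roots and their asymptotic normality. -/

open OneShot in
theorem mainTheorem6 {J I r : ℕ} (γ : ℝ) (hγ : 0 ≤ γ)
    -- inspection times and stress levels
    (τ : Fin I → ℝ) (hτ : ∀ i, 0 < τ i) (x : Fin I → Fin (J + 1) → ℝ)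
    -- the restrictions and the true parameter
    (m : OneShot.Param J → EuclideanSpace ℝ (Fin r)) (θ₀ : OneShot.Param J)
    (hm₀ : m θ₀ = 0)
    (hm_diff : ∀ᶠ θ in 𝓝 θ₀, DifferentiableAt ℝ m θ)
    (hm_cont : ContinuousAt (OneShot.restrMatrix m) θ₀)
    (hm_rank : (OneShot.restrMatrix m θ₀).rank = r)
    -- the numbers of devices in the experiments and their limiting proportions
    (K : ℕ → Fin I → ℕ) (w : Fin I → ℝ)
    (hK : Tendsto (fun n => ∑ i, K n i) atTop atTop)
    (hw : ∀ i, Tendsto (fun n => (K n i : ℝ) / ((∑ i', K n i' : ℕ) : ℝ)) atTop (𝓝 (w i)))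
    (hJ : IsUnit (OneShot.matJ γ τ x w θ₀).det)
    -- the lifetimes
    {Ω : Type*} [MeasurableSpace Ω] (P : Measure Ω) [IsProbabilityMeasure P]
    (T : (n : ℕ) → (i : Fin I) → Fin (K n i) → Ω → ℝ)
    (hT_law : ∀ n i k, HasLaw (T n i k)
      (OneShot.logLogisticMeasure (OneShot.scale (x i) θ₀) (OneShot.shape (x i) θ₀)) P)
    (hT_indep : ∀ n, iIndepFun (fun p : (i : Fin I) × Fin (K n i) => T n p.1 p.2) P) :
    -- the estimating equations have a consistent sequence of roots, computed from the data
    (∃ est : ℕ → (Fin I → ℕ) → OneShot.Param J,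
      Tendsto (fun n => P {ω | ¬ OneShot.IsRestrictedRoot γ τ x m (K n)
          (fun i => OneShot.failures (T n i) (τ i) ω)
          (est n fun i => OneShot.failures (T n i) (τ i) ω)}) atTop (𝓝 0) ∧
      TendstoInMeasure P (fun n ω => est n fun i => OneShot.failures (T n i) (τ i) ω)
        atTop (fun _ => θ₀)) ∧
    -- every consistent sequence of roots is asymptotically normal
    (∀ est : ℕ → Ω → OneShot.Param J,
      (∀ n, AEMeasurable (est n) P) →
      Tendsto (fun n => P {ω | ¬ OneShot.IsRestrictedRoot γ τ x m (K n)
          (fun i => OneShot.failures (T n i) (τ i) ω) (est n ω)}) atTop (𝓝 0) →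
      TendstoInMeasure P est atTop (fun _ => θ₀) →
      TendstoInDistribution
        (fun n ω => √((∑ i, K n i : ℕ) : ℝ) • (est n ω - θ₀)) atTop
        (id : OneShot.Param J → OneShot.Param J) (fun _ => P)
        (multivariateGaussian 0 (OneShot.asympCov γ τ x w m θ₀))) := by
  classical
  set N : ℕ → ℕ := fun n => ∑ i, K n i with hN
  have hNpos : ∀ᶠ n in atTop, (0 : ℝ) < N n := by
    filter_upwards [hK.eventually_gt_atTop 0] with n hn
    exact_mod_cast hn
  have hw0 : ∀ i, 0 ≤ w i := fun i => ge_of_tendsto' (hw i) fun n => by positivity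
  have hwK : Tendsto (fun n i => (K n i : ℝ) / N n) atTop (𝓝 w) := tendsto_pi_nhds.2 hw
  let q : Fin I → ℝ := fun i => failProb (τ i) (x i) θ₀
  have hq : ∀ i, 0 ≤ q i := fun i => (failProb_pos (hτ i) (x i) θ₀).le
  have hq1 : ∀ i, q i ≤ 1 := fun i => (failProb_lt_one (hτ i) (x i) θ₀).le
  have hμ : ∀ i, logLogisticMeasure (scale (x i) θ₀) (shape (x i) θ₀) (Set.Iic (τ i)) =
      ENNReal.ofReal (q i) := fun i =>
    logLogisticMeasure_Iic (scale_pos _ _) (shape_pos _ _) (hτ i)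
  have hcheb : ∀ n, ∀ c : ℝ, 0 < c →
      P {ω | ∃ i, c ≤ |(failures (T n i) (τ i) ω : ℝ) - K n i * q i|} ≤
        I * ENNReal.ofReal (N n / c ^ 2) := fun n c hc =>
    measure_exists_failures_ge_le (hT_law n) hq hq1 hμ (hT_indep n) hc
  constructor
  · let root : ℕ → (Fin I → ℕ) → Set (Param J) := fun n c => {θ | IsRestrictedRoot γ τ x m (K n) c θ}
    -- The estimator is an almost nearest root to `θ₀`, with slack tending to zero; it depends on
    -- the data through the counts alone.
    have hchoice : ∀ n c, ∃ θ, (root n c).Nonempty → θ ∈ root n c ∧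
        ∀ θ' ∈ root n c, dist θ θ₀ ≤ dist θ' θ₀ + 1 / ((n : ℝ) + 1) := fun n c => by
      by_cases h : (root n c).Nonempty
      · obtain ⟨θ, hθ, h'⟩ := exists_almost_nearest h θ₀
          (ε := 1 / ((n : ℝ) + 1)) (by positivity)
        exact ⟨θ, fun _ => ⟨hθ, h'⟩⟩
      · exact ⟨θ₀, fun h' => absurd h' h⟩
    choose est hest using hchoice
    have hex : ∀ ε : ℝ, 0 < ε → Tendsto (fun n => P {ω | ¬ ∃ θ ∈ Metric.ball θ₀ ε,
        θ ∈ root n fun i => failures (T n i) (τ i) ω}) atTop (𝓝 0) := by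
      intro ε hε
      have hroot := eventually_exists_root γ hτ x hw0 hm₀ hm_diff hm_cont hm_rank hJ
        (Metric.ball_mem_nhds θ₀ hε)
      -- In terms of proportions and centred frequencies the limit point is `(w, 0)`, so the
      -- deterministic and the random condition separate in a product neighbourhood.
      have hshift : Continuous fun p : (Fin I → ℝ) × (Fin I → ℝ) =>
          (p.1, fun i => p.2 i + p.1 i * q i) := by fun_prop
      have hshift' : Tendsto (fun p : (Fin I → ℝ) × (Fin I → ℝ) =>
          (p.1, fun i => p.2 i + p.1 i * q i)) (𝓝 (w, 0)) (𝓝 (w, fun i => w i * q i)) := by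
        simpa using hshift.tendsto (w, 0)
      have hev := hshift'.eventually hroot
      rw [nhds_prod_eq] at hev
      obtain ⟨A, hA, B, hB, hAB⟩ := eventually_prod_iff.1 hev
      obtain ⟨δ, hδ, hδB⟩ := Metric.eventually_nhds_iff_ball.1 hB
      have hbound : Tendsto (fun n => (I : ENNReal) * ENNReal.ofReal (1 / (δ ^ 2 * N n))) atTop
          (𝓝 0) := by
        have h1 : Tendsto (fun n => 1 / (δ ^ 2 * (N n : ℝ))) atTop (𝓝 0) :=
          (tendsto_natCast_atTop_atTop.comp hK |>.const_mul_atTop (by positivity)).const_div_atTop 1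
        have h2 := (ENNReal.tendsto_ofReal h1)
        rw [ENNReal.ofReal_zero] at h2
        simpa using ENNReal.Tendsto.const_mul h2 (Or.inr (ENNReal.natCast_ne_top I))
      refine tendsto_of_tendsto_of_tendsto_of_le_of_le' tendsto_const_nhds hbound
        (Eventually.of_forall fun _ => zero_le) ?_
      filter_upwards [hNpos, hwK.eventually hA] with n hn hAn
      have hc := hcheb n (δ * N n) (by positivity)
      rw [show (N n : ℝ) / (δ * N n) ^ 2 = 1 / (δ ^ 2 * N n) by field_simp] at hc
      refine (measure_mono fun ω hω => ?_).trans hc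
      by_contra hcon
      simp only [Set.mem_ofPred_eq, not_exists, not_le] at hcon
      apply hω
      have hz : B fun i => (failures (T n i) (τ i) ω : ℝ) / N n - K n i / N n * q i := by
        apply hδB
        rw [mem_ball_zero_iff, pi_norm_lt_iff hδ]
        intro i
        have h1 : (failures (T n i) (τ i) ω : ℝ) / N n - K n i / N n * q i =
            ((failures (T n i) (τ i) ω : ℝ) - K n i * q i) / N n := by ring
        rw [h1, Real.norm_eq_abs, abs_div, abs_of_pos hn, div_lt_iff₀ hn]
        exact hcon i
      obtain ⟨θ, hθ, hr⟩ := hAB hAn hz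
      refine ⟨θ, hθ, (isRestrictedRoot_iff γ hτ x m (K n) _ hn θ).2 ?_⟩
      simpa only [sub_add_cancel] using hr
    refine ⟨est, ?_, ?_⟩
    · refine tendsto_of_tendsto_of_tendsto_of_le_of_le tendsto_const_nhds (hex 1 one_pos)
        (fun _ => zero_le) fun n => measure_mono fun ω hω hcon => hω ?_
      obtain ⟨θ, -, hθ⟩ := hcon
      exact (hest n _ ⟨θ, hθ⟩).1
    · rw [tendstoInMeasure_iff_dist]
      intro ε hε
      refine tendsto_of_tendsto_of_tendsto_of_le_of_le' tendsto_const_nhds (hex (ε / 2) (half_pos hε))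
        (Eventually.of_forall fun _ => zero_le) ?_
      filter_upwards [(tendsto_one_div_add_atTop_nhds_zero_nat (𝕜 := ℝ)).eventually_lt_const
        (half_pos hε)] with n hn
      refine measure_mono fun ω hω hcon => ?_
      obtain ⟨θ, hθ, hr⟩ := hcon
      have h1 := (hest n _ ⟨θ, hr⟩).2 θ hr
      rw [Metric.mem_ball] at hθ
      rw [Set.mem_ofPred_eq] at hω
      linarith
  · intro est hmeas hroot hcons
    have hclt := tendstoInDistribution_sum_failures hK hw hT_law hq hq1 hμ hT_indep
      (leadingTerm γ τ x w m θ₀) (asympCov_posSemidef γ hτ x hw0 m θ₀)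
      (dotProduct_asympCov_mulVec γ hτ x hw0 m θ₀)
    -- Slutsky: it suffices that the scaled root minus the scaled leading term tends to zero in
    -- probability.
    refine tendstoInDistribution_of_tendstoInMeasure_sub _ _ hclt ?_
      fun n => AEMeasurable.fun_const_smul ((hmeas n).sub_const θ₀) _
    rw [tendstoInMeasure_iff_norm]
    intro ε hε
    rw [ENNReal.tendsto_nhds_zero]
    intro δ hδ
    have hδ3 : 0 < δ / 3 := ENNReal.div_pos hδ.ne' (by norm_num)
    -- Tightness: outside an event of probability at most `δ / 3`, all centred counts stay below `C
    -- * √N`.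
    obtain ⟨C, hC, hC0⟩ : ∃ C : ℝ, (I : ENNReal) * ENNReal.ofReal (1 / C ^ 2) ≤ δ / 3 ∧ 0 < C := by
      have h1 : Tendsto (fun C : ℝ => 1 / C ^ 2) atTop (𝓝 0) :=
        (tendsto_pow_atTop two_ne_zero).const_div_atTop 1
      have h2 := ENNReal.tendsto_ofReal h1
      rw [ENNReal.ofReal_zero] at h2
      have h3 := ENNReal.Tendsto.const_mul (a := (I : ENNReal)) h2
        (Or.inr (ENNReal.natCast_ne_top I))
      rw [mul_zero] at h3
      exact ((ENNReal.tendsto_nhds_zero.1 h3 _ hδ3).and (eventually_gt_atTop 0)).exists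
    -- With relative error `ε / (2 * C)` and centred frequencies at most `C / √N`, the scaled
    -- remainder is at most `ε / 2`.
    have hev := eventually_root_bound γ hτ x hw0 hm₀ hm_diff.self_of_nhds hm_cont hm_rank hJ
      (c := ε / (2 * C)) (by positivity)
    rw [nhds_prod_eq] at hev
    obtain ⟨A, hA, B, hB, hAB⟩ := eventually_prod_iff.1 hev
    obtain ⟨ρ, hρ, hρB⟩ := Metric.eventually_nhds_iff_ball.1 hB
    rw [tendstoInMeasure_iff_dist] at hcons
    filter_upwards [hNpos, hwK.eventually hA, ENNReal.tendsto_nhds_zero.1 hroot _ hδ3,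
      ENNReal.tendsto_nhds_zero.1 (hcons ρ hρ) _ hδ3] with n hn hAn h1 h2
    have hs : 0 < √(N n : ℝ) := Real.sqrt_pos.2 hn
    have h3 := hcheb n (C * √(N n)) (by positivity)
    rw [show (N n : ℝ) / (C * √(N n)) ^ 2 = 1 / C ^ 2 by
      rw [mul_pow, Real.sq_sqrt hn.le]; field_simp] at h3
    rw [← ENNReal.add_thirds δ]
    -- Three exceptional events cost `δ / 3` each: not being a root, being far from `θ₀`, and some
    -- centred count being large.
    refine (measure_mono ?_).trans ((measure_union_le _ _).trans (add_le_add
      ((measure_union_le _ _).trans (add_le_add h1 h2)) (h3.trans hC)))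
    intro ω hω
    by_contra hcon
    simp only [Set.mem_union, Set.mem_ofPred_eq, not_or, not_not, not_exists, not_le] at hcon
    obtain ⟨⟨hr, hd⟩, hf⟩ := hcon
    have hb := hAB hAn (hρB _ (Metric.mem_ball.2 hd)) _
      ((isRestrictedRoot_iff γ hτ x m (K n) _ hn (est n ω)).1 hr)
    have hz : ∀ i, (failures (T n i) (τ i) ω : ℝ) / N n - K n i / N n * failProb (τ i) (x i) θ₀ =
        ((failures (T n i) (τ i) ω : ℝ) - K n i * q i) / N n := fun i => by
      simp only [q]; ring
    simp only [hz] at hb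
    have hnorm : ‖fun i => ((failures (T n i) (τ i) ω : ℝ) - K n i * q i) / N n‖ ≤ C / √(N n) := by
      refine (pi_norm_le_iff_of_nonneg (by positivity)).2 fun i => ?_
      rw [Real.norm_eq_abs, abs_div, abs_of_pos hn, div_le_div_iff₀ hn hs]
      calc _ ≤ C * √(N n) * √(N n) := by gcongr; exact (hf i).le
        _ = C * N n := by rw [mul_assoc, Real.mul_self_sqrt hn.le]
    have hscale : √(N n : ℝ) • (est n ω - θ₀) - ∑ i, ((√(N n : ℝ))⁻¹ *
        ((failures (T n i) (τ i) ω : ℝ) - K n i * q i)) • leadingTerm γ τ x w m θ₀ i =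
        √(N n : ℝ) • (est n ω - θ₀ - ∑ i, (((failures (T n i) (τ i) ω : ℝ) - K n i * q i) / N n) •
          leadingTerm γ τ x w m θ₀ i) := by
      rw [smul_sub _ (est n ω - θ₀), Finset.smul_sum]
      congr 1
      refine Finset.sum_congr rfl fun i _ => ?_
      rw [smul_smul]
      congr 1
      nth_rewrite 3 [← Real.mul_self_sqrt hn.le]
      field_simp
    have hω' : ε ≤ ‖√(N n : ℝ) • (est n ω - θ₀) - ∑ i, ((√(N n : ℝ))⁻¹ *
        ((failures (T n i) (τ i) ω : ℝ) - K n i * q i)) • leadingTerm γ τ x w m θ₀ i‖ := by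
      rw [Set.mem_ofPred_eq, Pi.zero_apply, sub_zero] at hω
      exact hω
    rw [hscale, norm_smul, Real.norm_of_nonneg hs.le] at hω'
    have : √(N n : ℝ) * (ε / (2 * C) * (C / √(N n))) = ε / 2 := by field_simp
    have h4 := mul_le_mul_of_nonneg_left (hb.trans (mul_le_mul_of_nonneg_left hnorm
      (by positivity))) hs.le
    linarith
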